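/- **Setting.** Let $\mathcal S,\mathcal A$ be finite, $\Delta_{\mathcal S}$ the probability simplex over $\mathcal S$, $c:\mathcal S\times\mathcal A\to[0,1]$ a cost, $\gamma\in[0,1)$, $\zeta\in[0,1]$, $\overline{\mathbb P}$ a transition kernel, $\vartheta$ a randomized stationary policy, and for every $s$ let $\mathcal D_s\subseteq\Delta_{\mathcal S}^{|\mathcal A|}$ be nonempty and convex. For $\pi\in\Pi=\prod_s\mathcal D_s$ let $\mathtt P^\pi(s,s')=\sum_a\vartheta(a|s)[(1-\zeta)\overline{\mathbb P}_{s,a}(s')+\zeta\pi(s)_a(s')]$, $\mathfrak C(s)=-\sum_a\vartheta(a|s)c(s,a)$, $\mathcal V^\pi=\sum_{t\ge0}\gamma^t(\mathtt P^\pi)^t\mathfrak C$ and $\mathcal V^*(s)=\inf_{\pi\in\Pi}\mathcal V^\pi(s)$. Thus $-\mathcal V^*$ is the robust value function of $\vartheta$, the supremum of its value functions over all kernels $\mathbb P$ with $\mathbb P_s\in\{(1-\zeta)\overline{\mathbb P}_s+\zeta\mathbb D:\mathbb D\in\mathcal D_s\}$ for every $s$. *Distance generating functions.* Let $\mu_w,\overline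 w>0$ and let $w_s:\Delta_{\mathcal S}^{|\mathcal A|}\to[0,\overline w]$ be convex with $w_s(\mathbb D')-w_s(\mathbb D)-\langle\nabla w_s(\mathbb D),\mathbb D'-\mathbb D\rangle\ge\frac{\mu_w}{2}\sum_a\vartheta(a|s)\|\mathbb D_a-\mathbb D'_a\|_1^2$ for all $\mathbb D,\mathbb D'$. Here $\langle\nabla w_s(\mathbb D),\mathbb D'-\mathbb D\rangle$ is the one-sided directional derivative; nothing is required where it is not finite. *Simulator-based evaluation (SE) with $l$ steps.* In step $i=0,\dots,l-1$, for every $s$ sample $a\sim\vartheta(\cdot|s)$ and $s'\sim\overline{\mathbb P}_{s,a}$; let $\hat{\mathbb P}_i$ be the $0/1$ matrix of the sampled pairs $(s,s')$. With $R_0=I$ and $R_{i+1}=R_i\big((1-\zeta)\hat{\mathbb P}_i+\zeta\,\mathbb D^{\pi,\vartheta}\big)$, $\mathbb D^{\pi,\vartheta}(s,s')=\sum_a\vartheta(a|s)\pi(s)_a(s')$, the output is $\hat{\mathcal V}^\pi=\sum_{i=0}^{l}\gamma^iR_i\mathfrak C$. *SFRPE.* From an arbitrary $\pi_0\in\Pi$,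 for $k=0,1,\dots$ compute $\hat{\mathcal V}^{\pi_k}$ by SE with fresh independent samples and let $$\pi_{k+1}(s)\in\operatorname*{argmin}_{\mathbb D\in\mathcal D_s}\ \gamma\zeta\sum_{t=0}^k\beta_t\sum_a\vartheta(a|s)\langle\mathbb D_a,\hat{\mathcal V}^{\pi_t}\rangle+\lambda_kw_s(\mathbb D)$$ (any choice among minimizers that is determined by the samples of iterations $0,\dots,k$), where $$\beta_k=k^{1/2},\qquad \lambda_k=\frac{(k+1)\gamma\zeta}{2(1-\gamma)\sqrt{\mu_w\overline w}}.$$ The output after $k\ge1$ iterations is $\sum_{t=1}^k\theta_t\hat{\mathcal V}^{\pi_t}$, $\theta_t=\beta_t/\sum_{j=1}^k\beta_j$. Iterations $0,\dots,k$ use $(k+1)\,l\,|\mathcal S|$ samples. **Theorem.** (1) For any $l\ge0$, $k\ge1$ and $\delta\in(0,1)$, with probability at least $1-\delta$ it holds for all $s\in\mathcal S$ that $$-\Big[\tfrac{\gamma^l}{1-\gamma}+\tfrac{4}{(1-\gamma)\sqrt k}\log\tfrac{4|\mathcal S|}{\delta}\Big]\le\sum_{t=1}^k\theta_t\hat{\mathcal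 V}^{\pi_t}(s)-\mathcal V^*(s)$$ $$\le\tfrac{4\gamma\zeta\sqrt{\overline w}}{(1-\gamma)^2\sqrt{\mu_wk}}+\tfrac{\gamma\zeta}{1-\gamma}\Big(\tfrac{2\gamma^l}{1-\gamma}+\tfrac{8}{(1-\gamma)\sqrt k}\sqrt{\log\tfrac{2|\mathcal S|}{\delta}}\Big)+\tfrac{\gamma^l}{1-\gamma}+\tfrac{4}{(1-\gamma)\sqrt k}\sqrt{\log\tfrac{4|\mathcal S|}{\delta}}.$$ (2) For every $p\in\mathbb N$ there is a constant $K>0$, depending only on $p$, such that for all $|\mathcal S|\ge2$, $\gamma$, $\zeta$, $\overline w$, $\mu_w$, $\delta\in(0,1)$ and all $\epsilon>0$ with $\epsilon^p\le(1-\gamma)/2$ there are $k\ge1$ and $l$, depending only on these parameters, for which, in every problem with these parameters, $-\epsilon\le\sum_{t=1}^k\theta_t\hat{\mathcal V}^{\pi_t}(s)-\mathcal V^*(s)\le\epsilon$ holds for all $s$ with probability at least $1-\delta$, and the number of samples is at most $$K\Big(\frac{\gamma^2\zeta^2\overline w|\mathcal S|\log(1/\epsilon)}{(1-\gamma)^5\mu_w\epsilon^2}\log\frac{|\mathcal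 S|}{\delta}+\frac{|\mathcal S|\log(1/\epsilon)}{(1-\gamma)^3\epsilon^2}\log\frac{|\mathcal S|}{\delta}\Big).$$ (3) In particular, for $w_s(\mathbb D)=\sum_a\vartheta(a|s)\sum_{s'}\mathbb D_a(s')\log\mathbb D_a(s')+\log|\mathcal S|$, with $\overline w=\log|\mathcal S|$ and $\mu_w=1$ in $\lambda_k$, the assertion of (2) holds with the bound $$K\Big(\frac{\gamma^2\zeta^2|\mathcal S|\log|\mathcal S|\log(1/\epsilon)}{(1-\gamma)^5\epsilon^2}\log\frac{|\mathcal S|}{\delta}+\frac{|\mathcal S|\log(1/\epsilon)}{(1-\gamma)^3\epsilon^2}\log\frac{|\mathcal S|}{\delta}\Big).$$ -/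

import Mathlib

open MeasureTheory ProbabilityTheory

noncomputable section

namespace RobustEval

/-- The set `Δ_S^A` of families `D = (D_a)_{a ∈ A}` of probability vectors over `S`. -/
def simplexFamily (S A : Type*) [Fintype S] : Set (A → S → ℝ) :=
  {D | ∀ a, D a ∈ stdSimplex ℝ S}

/-- A policy evaluation problem for a robust MDP with finite state space `S`, finite action space
`A` and an `s`-rectangular ambiguity set `𝒫 = ∏ₛ {(1 - ζ) P̄ₛ + ζ D : D ∈ 𝒟ₛ}`. -/
structure Problem (S A : Type*) [Fintype S] [Fintype A] where
  /-- the cost function -/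
  c : S → A → ℝ
  c_mem : ∀ s a, c s a ∈ Set.Icc (0 : ℝ) 1
  /-- the discount factor -/
  γ : ℝ
  γ_nonneg : 0 ≤ γ
  γ_lt_one : γ < 1
  /-- the size of the ambiguity set -/
  ζ : ℝ
  ζ_mem : ζ ∈ Set.Icc (0 : ℝ) 1
  /-- the nominal transition kernel, `Pbar s a s'` being the probability of moving from `s` to `s'`
  under the action `a` -/
  Pbar : S → A → S → ℝ
  Pbar_mem : ∀ s, Pbar s ∈ simplexFamily S A
  /-- the sets `𝒟ₛ` that shape the ambiguity set -/
  D : S → Set (A → S → ℝ)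
  D_subset : ∀ s, D s ⊆ simplexFamily S A
  D_convex : ∀ s, Convex ℝ (D s)
  D_nonempty : ∀ s, (D s).Nonempty
  /-- the randomized stationary policy `ϑ(a | s)` to be evaluated -/
  ϑ : S → A → ℝ
  ϑ_mem : ∀ s, ϑ s ∈ stdSimplex ℝ A

variable {S A : Type*} [Fintype S] [Fintype A]

namespace Problem

/-- The transition matrix of the state chain when `ϑ` is run with the transition kernel `P`. -/
def chain (M : Problem S A) (P : S → A → S → ℝ) : Matrix S S ℝ :=
  Matrix.of fun s s' => ∑ a, P s a s' * M.ϑ s a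

/-- The expected one-step cost of `ϑ`. -/
def policyCost (M : Problem S A) (s : S) : ℝ := ∑ a, M.ϑ s a * M.c s a

/-- The value function of `ϑ` in the MDP with kernel `P`:
`𝔼[∑ₜ γᵗ c(sₜ, aₜ) | s₀ = s] = ∑ₜ γᵗ ∑ₛ' Pr(sₜ = s' | s₀ = s) ∑ₐ ϑ(a|s') c(s', a)`. -/
def value [DecidableEq S] (M : Problem S A) (P : S → A → S → ℝ) (s : S) : ℝ :=
  ∑' t : ℕ, M.γ ^ t * ((M.chain P) ^ t).mulVec M.policyCost s

/-- The set of transition kernels `𝒫 = ∏ₛ 𝒫ₛ`, `𝒫ₛ = {(1 - ζ) P̄ₛ + ζ D : D ∈ 𝒟ₛ}`. -/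
def ambiguitySet (M : Problem S A) : Set (S → A → S → ℝ) :=
  {P | ∀ s, ∃ D ∈ M.D s, P s = (1 - M.ζ) • M.Pbar s + M.ζ • D}

/-- The robust (worst-case) value function of `ϑ`. -/
def robustValue [DecidableEq S] (M : Problem S A) (s : S) : ℝ :=
  ⨆ P : M.ambiguitySet, M.value P s

/-! ### The MDP of nature -/

/-- The non-randomized stationary policies of nature. -/
def policies (M : Problem S A) : Set (S → A → S → ℝ) := {π | ∀ s, π s ∈ M.D s}

/-- The kernel `P^π = (1 - ζ) P̄ + ζ π` determined by a policy `π` of nature. -/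
def kernelOf (M : Problem S A) (π : S → A → S → ℝ) : S → A → S → ℝ :=
  fun s => (1 - M.ζ) • M.Pbar s + M.ζ • π s

/-- The cost of nature. -/
def natureCost (M : Problem S A) (s : S) : ℝ := -∑ a, M.ϑ s a * M.c s a

/-- The value function `𝒱^π(s) = 𝔼[∑ₜ γᵗ ℭ(sₜ) | s₀ = s]` of a policy `π` of nature. -/
def natureValue [DecidableEq S] (M : Problem S A) (π : S → A → S → ℝ) (s : S) : ℝ :=
  ∑' t : ℕ, M.γ ^ t * ((M.chain (M.kernelOf π)) ^ t).mulVec M.natureCost s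

/-- The optimal value function `𝒱^*(s)`, the infimum of `𝒱^π(s)` over all policies `π`. -/
def natureOptValue [DecidableEq S] (M : Problem S A) (s : S) : ℝ :=
  ⨅ π : M.policies, M.natureValue π s

theorem natureValue_eq_neg_value [DecidableEq S] (M : Problem S A) (π : S → A → S → ℝ) (s : S) :
    M.natureValue π s = -M.value (M.kernelOf π) s := by
  have h : M.natureCost = -M.policyCost := rfl
  simp [natureValue, value, h, Matrix.mulVec_neg, tsum_neg]

/-- The optimal value function of nature is the negative of the robust value function. -/
theorem natureOptValue_eq_neg_robustValue [DecidableEq S] (M : Problem S A) (s : S) :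
    M.natureOptValue s = -M.robustValue s := by
  have hset : M.ambiguitySet = M.kernelOf '' M.policies := by
    ext P
    constructor
    · intro h
      choose D hD hP using h
      exact ⟨D, hD, funext fun s => (hP s).symm⟩
    · rintro ⟨π, hπ, rfl⟩ s
      exact ⟨π s, hπ s, rfl⟩
  have h1 : M.robustValue s = sSup ((fun P => M.value P s) '' M.ambiguitySet) := by
    rw [robustValue, sSup_image']
  have h2 : M.natureOptValue s = sInf ((fun π => M.natureValue π s) '' M.policies) := by
    rw [natureOptValue, sInf_image']
  rw [h1, h2, hset, Set.image_image, Real.sInf_def]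
  congr 2
  ext x
  simp only [Set.mem_neg, Set.mem_image, natureValue_eq_neg_value, neg_inj]

/-! ### The simulator-based evaluation operator -/

/-- The matrix `(1 - ζ) P̂ + ζ D^{π,ϑ}` built from one batch of next states, `x s` being the next
state sampled at `s`. -/
def seMatrix [DecidableEq S] (M : Problem S A) (π : S → A → S → ℝ) (x : S → S) : Matrix S S ℝ :=
  Matrix.of fun s s' =>
    (1 - M.ζ) * (if x s = s' then 1 else 0) + M.ζ * ∑ a, M.ϑ s a * π s a s'

/-- The product `R_i` of the matrices of the first `i` batches; `R_0 = I`. -/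
def seProd [DecidableEq S] (M : Problem S A) (π : S → A → S → ℝ) (x : ℕ → S → S) :
    ℕ → Matrix S S ℝ
  | 0 => 1
  | i + 1 => M.seProd π x i * M.seMatrix π (x i)

/-- The output `∑_{i=0}^{l} γ^i R_i ℭ` of the simulator-based evaluation of `𝒱^π` from `l` batches
of samples. -/
def seEstimate [DecidableEq S] (M : Problem S A) (l : ℕ) (π : S → A → S → ℝ) (x : ℕ → S → S)
    (s : S) : ℝ :=
  ∑ i ∈ Finset.range (l + 1), M.γ ^ i * (M.seProd π x i).mulVec M.natureCost s

/-! ### Distance generating functions -/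

/-- `w` is a family of convex distance generating functions with values in `[0, wbar]` on `Δ_S^A`,
whose Bregman divergence satisfies
`w_s(D') - w_s(D) - ⟨∇w_s(D), D' - D⟩ ≥ (μ/2) ∑_a ϑ(a|s) ‖D_a - D'_a‖₁²`.
The number `⟨∇w_s(D), D' - D⟩` is the one-sided derivative of `w_s` at `D` along the segment towards
`D'`. Where this derivative is `-∞` (as for the negative entropy at some boundary points) the
divergence is `+∞` and nothing is required. -/
structure IsDGF (M : Problem S A) (w : S → (A → S → ℝ) → ℝ) (wbar μ : ℝ) : Prop where
  convexOn : ∀ s, ConvexOn ℝ (simplexFamily S A) (w s)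
  nonneg : ∀ s, ∀ D ∈ simplexFamily S A, 0 ≤ w s D
  le_wbar : ∀ s, ∀ D ∈ simplexFamily S A, w s D ≤ wbar
  bregman_ge : ∀ s, ∀ D ∈ simplexFamily S A, ∀ D' ∈ simplexFamily S A, ∀ g : ℝ,
    HasDerivWithinAt (fun τ : ℝ => w s (D + τ • (D' - D))) g (Set.Ici 0) 0 →
      μ / 2 * ∑ a, M.ϑ s a * (∑ s', |D a s' - D' a s'|) ^ 2 ≤ w s D' - w s D - g

/-- The weighted negative entropy `∑_a ϑ(a|s) ∑_s' D_a(s') log D_a(s') + log |S|`. -/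
def negEntropy (M : Problem S A) (s : S) (D : A → S → ℝ) : ℝ :=
  (∑ a, M.ϑ s a * ∑ s', D a s' * Real.log (D a s')) + Real.log (Fintype.card S)

/-! ### Stochastic first-order robust policy evaluation -/

/-- The objective `γ ζ ∑_{t ≤ k} β_t ⟨D, ϑ(·|s) ⊗ V_t⟩ + lam_k w_s(D)` of the `k`-th update. -/
def objective (M : Problem S A) (w : S → (A → S → ℝ) → ℝ) (β lam : ℕ → ℝ) (V : ℕ → S → ℝ) (k : ℕ)
    (s : S) (D : A → S → ℝ) : ℝ :=
  M.γ * M.ζ * (∑ t ∈ Finset.range (k + 1), β t * ∑ a, ∑ s', D a s' * (M.ϑ s a * V t s')) +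
    lam k * w s D

end Problem

/-- A run of stochastic first-order robust policy evaluation with `l`-step simulator-based
evaluation. In iteration `t` and inner step `i`, a pair `ξ t i s` of an action `a ∼ ϑ(·|s)` and a
next state `s' ∼ P̄_{s,a}` is sampled for every `s`, all samples being independent. The policy `π t`
is determined by the samples of the earlier iterations. -/
structure Run [DecidableEq S] (M : Problem S A) (w : S → (A → S → ℝ) → ℝ) (β lam : ℕ → ℝ) (l : ℕ)
    {Ω : Type*} [MeasurableSpace Ω] (Pr : Measure Ω) where
  ξ : ℕ → ℕ → S → Ω → A × S
  π : ℕ → Ω → S → A → S → ℝ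
  measurableSet_ξ : ∀ t i s z, MeasurableSet {ω | ξ t i s ω = z}
  law_ξ : ∀ t i s a s', Pr.real {ω | ξ t i s ω = (a, s')} = M.ϑ s a * M.Pbar s a s'
  indep_ξ : iIndepFun (m := fun _ => ⊤) (fun j : ℕ × ℕ × S => ξ j.1 j.2.1 j.2.2) Pr
  init_mem : ∀ ω, π 0 ω ∈ M.policies
  adapted : ∀ t ω ω', (∀ r < t, ∀ i < l, ∀ s, ξ r i s ω = ξ r i s ω') → π t ω = π t ω'
  update_mem : ∀ k ω s, π (k + 1) ω s ∈ M.D s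
  update_min : ∀ k ω s, IsMinOn
    (M.objective w β lam (fun t => M.seEstimate l (π t ω) (fun i s => (ξ t i s ω).2)) k s)
    (M.D s) (π (k + 1) ω s)

/-- The estimate `V̂^{π_t}` computed in iteration `t` of a run. -/
def Run.estimate [DecidableEq S] {M : Problem S A} {w : S → (A → S → ℝ) → ℝ} {β lam : ℕ → ℝ}
    {l : ℕ} {Ω : Type*} [MeasurableSpace Ω] {Pr : Measure Ω} (R : Run M w β lam l Pr)
    (t : ℕ) (ω : Ω) (s : S) : ℝ :=
  M.seEstimate l (R.π t ω) (fun i s => (R.ξ t i s ω).2) s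

/-- The output `∑_{t=1}^{k} θ_t V̂^{π_t}`, `θ_t = β_t / ∑_{j=1}^{k} β_j`, of a run. -/
def Run.output [DecidableEq S] {M : Problem S A} {w : S → (A → S → ℝ) → ℝ} {β lam : ℕ → ℝ}
    {l : ℕ} {Ω : Type*} [MeasurableSpace Ω] {Pr : Measure Ω} (R : Run M w β lam l Pr)
    (k : ℕ) (ω : Ω) (s : S) : ℝ :=
  ∑ t ∈ Finset.Icc 1 k, β t / (∑ j ∈ Finset.Icc 1 k, β j) * R.estimate t ω s

/-- The weights `β_k = k^{1/2}`. -/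
def betaSeq (k : ℕ) : ℝ := √(k : ℝ)

/-- The parameters `λ_k = (k + 1) γ ζ / (2 (1 - γ) √(μ wbar))`. -/
def lamSeq (γ ζ wbar μ : ℝ) (k : ℕ) : ℝ := (k + 1) * γ * ζ / (2 * (1 - γ) * √(μ * wbar))

/-- The number of sampled transitions in the iterations `0, …, k`, each of which calls the
`l`-step simulator-based evaluation, which samples one transition per step and state. -/
def totalSamples (n l k : ℕ) : ℕ := (k + 1) * (l * n)

end RobustEval

end

/-! At each state the updates are dual averaging for the linear losses `γ ζ ⟨·, ϑ ⊗ V̂_t⟩`. The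
performance difference lemma `natureValue_sub_natureValue` writes `𝒱^{π_t}(s) - 𝒱^{π'}(s)` as the
integral of `γ ζ ⟨π_t(u) - π'(u), 𝒱^{π_t}⟩` against the occupancy measure of the comparator `π'`.
That measure has mass `1 / (1 - γ)` and does not depend on `t`. Hence the weighted suboptimality is
a mixture of weighted regrets at single states, up to replacing `𝒱^{π_t}` by its estimate.

The regret is bounded in `IsDGF.regret_le` by strong convexity. With `β_t = √t` and `λ_t`
proportional to `t + 1` every round costs the same, so the regret is `O(k)` against a total weight
of order `k^{3/2}`.

The replacement error has two parts. Truncation gives a bias in `[0, γ^l / (1 - γ)]`, nonnegative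
because nature's costs are nonpositive. The rest is a martingale difference: `π_t` is determined by
earlier samples, and independence of the batches makes their product unbiased for a power of the
chain. Azuma–Hoeffding is applied to three scalar martingales per state `s`: plus and minus the
error at `s`, and the error tested against the difference between `π_t` and the comparator. The
comparator is nonrandom, so a union bound over `S` suffices. It is only nearly optimal, since the
infimum need not be attained; the slack goes into the constants. In the lower bound only the noise
survives, because `𝒱^{π_t} ≥ 𝒱^*` and the bias has the right sign.

For the sample complexity, `ε ^ p ≤ (1 - γ) / 2` turns `log (1 / (1 - γ))` into a multiple of `log
(1 / ε)`. The noise term without the factor `wbar / μ` is absorbed through `IsDGF.le_four_mul`. For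
the negative entropy, the Bregman bound comes from Pinsker's inequality. -/

namespace RobustEval

/-! ### Azuma–Hoeffding for variables with finitely many values -/

section Martingale

variable {Ω E F : Type*} [MeasurableSpace Ω] {P : Measure Ω} [IsProbabilityMeasure P]
  [Finite E] [MeasurableSpace E] [DiscreteMeasurableSpace E]
  [Finite F] [MeasurableSpace F] [DiscreteMeasurableSpace F]

theorem integrable_of_factorsThrough {U : Ω → F} (hU : Measurable U) {f : Ω → ℝ}
    (hf : f.FactorsThrough U) : Integrable f P := by
  obtain ⟨e, rfl⟩ := (Function.factorsThrough_iff f).1 hf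
  obtain ⟨C, hC⟩ := (Set.finite_range fun x => ‖e x‖).bddAbove
  exact Integrable.of_bound ((Measurable.of_discrete).comp hU).aestronglyMeasurable C
    (Filter.Eventually.of_forall fun ω => hC ⟨U ω, rfl⟩)

/-- Freezing lemma: the variables that are independent of `Y` can be frozen when integrating
over `Y`. -/
theorem integral_eq_integral_integral_of_indepFun {U : Ω → F} {Y : Ω → E} (hU : Measurable U)
    (hY : Measurable Y) (h : IndepFun U Y P) {Ψ : Ω → E → ℝ} (hΨ : Ψ.FactorsThrough U) :
    ∫ ω, Ψ ω (Y ω) ∂P = ∫ ω, ∫ ω', Ψ ω (Y ω') ∂P ∂P := by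
  obtain ⟨g, rfl⟩ := (Function.factorsThrough_iff Ψ).1 hΨ
  have hm : Measurable (Function.uncurry g) := Measurable.of_discrete
  have hmap := (indepFun_iff_map_prod_eq_prod_map_map hU.aemeasurable hY.aemeasurable).1 h
  have := Measure.isProbabilityMeasure_map (μ := P) hU.aemeasurable
  have := Measure.isProbabilityMeasure_map (μ := P) hY.aemeasurable
  calc ∫ ω, g (U ω) (Y ω) ∂P
      = ∫ z, Function.uncurry g z ∂(P.map fun ω => (U ω, Y ω)) :=
        (integral_map (hU.prodMk hY).aemeasurable hm.aestronglyMeasurable).symm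
    _ = ∫ u, ∫ y, g u y ∂(P.map Y) ∂(P.map U) := by
        rw [hmap, integral_prod _ (.of_finite)]; rfl
    _ = ∫ u, ∫ ω', g u (Y ω') ∂P ∂(P.map U) := by
        congr 1; ext u
        exact integral_map hY.aemeasurable (Measurable.of_discrete).aestronglyMeasurable
    _ = _ := integral_map hU.aemeasurable (Measurable.of_discrete).aestronglyMeasurable

/-- Once `U` is frozen, the increment is centred and bounded by `b`, so Hoeffding's lemma bounds its
exponential moment by a constant that factors out of the integral over `U`. -/
theorem hasSubgaussianMGF_add_of_indepFun {U : Ω → F} {Y : Ω → E} (hU : Measurable U)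
    (hY : Measurable Y) (h : IndepFun U Y P) {T : Ω → ℝ} (hT : T.FactorsThrough U)
    {G : Ω → E → ℝ} (hG : G.FactorsThrough U) {b c : NNReal} (hb : ∀ ω e, |G ω e| ≤ b)
    (hmean : ∀ ω, ∫ ω', G ω (Y ω') ∂P = 0) (hTc : HasSubgaussianMGF T c P) :
    HasSubgaussianMGF (fun ω => T ω + G ω (Y ω)) (c + b ^ 2) P where
  integrable_exp_mul t := by
    refine integrable_of_factorsThrough (hU.prodMk hY) fun ω ω' hω => ?_
    simp only [Prod.mk.injEq] at hω
    simp only [hT hω.1, hG hω.1, hω.2]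
  mgf_le t := by
    have hin : ∀ ω, ∫ ω', Real.exp (t * G ω (Y ω')) ∂P ≤ Real.exp (b ^ 2 * t ^ 2 / 2) := by
      intro ω
      have hs := hasSubgaussianMGF_of_mem_Icc_of_integral_eq_zero (μ := P) (a := -b) (b := b)
        (X := fun ω' => G ω (Y ω')) ((Measurable.of_discrete).comp hY).aemeasurable
        (Filter.Eventually.of_forall fun ω' => abs_le.1 (hb ω (Y ω'))) (hmean ω)
      have h1 := hs.mgf_le t
      -- Hoeffding's parameter is the square of half the length of `[-b, b]`.
      have h2 : (((‖(b : ℝ) - -b‖₊ / 2) ^ 2 : NNReal) : ℝ) = b ^ 2 := by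
        push_cast
        have hb0 := b.coe_nonneg
        rw [Real.norm_of_nonneg (by linarith)]; ring
      rw [h2] at h1
      exact h1
    calc mgf (fun ω => T ω + G ω (Y ω)) P t
        = ∫ ω, Real.exp (t * T ω) * Real.exp (t * G ω (Y ω)) ∂P := by
          simp only [mgf, mul_add, Real.exp_add]
      _ = ∫ ω, Real.exp (t * T ω) * ∫ ω', Real.exp (t * G ω (Y ω')) ∂P ∂P := by
          rw [integral_eq_integral_integral_of_indepFun hU hY h
            (Ψ := fun ω e => Real.exp (t * T ω) * Real.exp (t * G ω e))]
          · simp only [integral_const_mul]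
          · intro ω ω' hω
            simp only [hT hω, hG hω]
      _ ≤ ∫ ω, Real.exp (t * T ω) * Real.exp (b ^ 2 * t ^ 2 / 2) ∂P := by
          refine integral_mono (integrable_of_factorsThrough hU fun ω ω' hω => ?_)
            ((hTc.integrable_exp_mul t).mul_const _) fun ω => ?_
          · simp only [hT hω, hG hω]
          · exact mul_le_mul_of_nonneg_left (hin ω) (Real.exp_nonneg _)
      _ ≤ Real.exp (c * t ^ 2 / 2) * Real.exp (b ^ 2 * t ^ 2 / 2) := by
          rw [integral_mul_const]
          exact mul_le_mul_of_nonneg_right (hTc.mgf_le t) (Real.exp_nonneg _)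
      _ = _ := by
          rw [← Real.exp_add]; push_cast; congr 1; ring

/-- Azuma–Hoeffding: `G n ω` is determined by the variables `Y r ω`, `r < n`. -/
theorem hasSubgaussianMGF_sum_of_indepFun {Y : ℕ → Ω → E} (hY : ∀ n, Measurable (Y n))
    (h : ∀ n, IndepFun (fun ω (i : Fin n) => Y i ω) (Y n) P) {G : ℕ → Ω → E → ℝ}
    (hG : ∀ n ω ω', (∀ r < n, Y r ω = Y r ω') → G n ω = G n ω') {b : ℕ → NNReal}
    (hb : ∀ n ω e, |G n ω e| ≤ b n) (hmean : ∀ n ω, ∫ ω', G n ω (Y n ω') ∂P = 0) (n : ℕ) :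
    HasSubgaussianMGF (fun ω => ∑ t ∈ Finset.range n, G t ω (Y t ω))
      (∑ t ∈ Finset.range n, b t ^ 2) P := by
  induction n with
  | zero => simp
  | succ n ih =>
    simp only [Finset.sum_range_succ]
    have hfac : ∀ {ω ω' : Ω}, (fun i : Fin n => Y i ω) = (fun i : Fin n => Y i ω') →
        ∀ r < n, Y r ω = Y r ω' := fun hω r hr => congrFun hω ⟨r, hr⟩
    refine hasSubgaussianMGF_add_of_indepFun (U := fun ω (i : Fin n) => Y i ω)
      (measurable_pi_lambda _ fun i => hY i) (hY n) (h n)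
      (fun ω ω' hω => Finset.sum_congr rfl fun t ht => ?_)
      (fun ω ω' hω => hG n ω ω' (hfac hω)) (hb n) (hmean n) ih
    have ht' := Finset.mem_range.1 ht
    rw [hG t ω ω' fun r hr => hfac hω r (hr.trans ht'), hfac hω t ht']

end Martingale

/-! ### The averaging weights -/

section Weights

theorem betaSeq_nonneg (t : ℕ) : 0 ≤ betaSeq t := Real.sqrt_nonneg _

theorem betaSeq_zero : betaSeq 0 = 0 := by simp [betaSeq]

theorem betaSeq_sq (t : ℕ) : betaSeq t ^ 2 = t := Real.sq_sqrt (Nat.cast_nonneg t)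

theorem sum_range_succ_eq_sum_Icc {f : ℕ → ℝ} (hf : f 0 = 0) (k : ℕ) :
    ∑ t ∈ Finset.range (k + 1), f t = ∑ t ∈ Finset.Icc 1 k, f t := by
  rw [Finset.range_eq_Ico, Finset.sum_eq_sum_Ico_succ_bot (Nat.succ_pos k), hf, zero_add]
  rfl

/-- The left side is `∫₀ᵏ √x dx`. -/
theorem le_sum_betaSeq (k : ℕ) :
    2 / 3 * (k * √(k : ℝ)) ≤ ∑ t ∈ Finset.Icc 1 k, betaSeq t := by
  induction k with
  | zero => simp
  | succ k ih =>
    rw [Finset.sum_Icc_succ_top (by omega)]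
    refine le_trans ?_ (add_le_add_left ih _)
    simp only [betaSeq]
    push_cast
    rcases Nat.eq_zero_or_pos k with rfl | hk
    · norm_num
    have hk' : (1 : ℝ) ≤ k := by exact_mod_cast hk
    -- This is the induction step rearranged; squared, it reads `4k³ - 3k + 1 ≤ 4k³`, which needs `k
    -- ≥ 1`.
    have h : (2 * k - 1) * √((k : ℝ) + 1) ≤ 2 * k * √(k : ℝ) := by
      refine abs_le_of_sq_le_sq' ?_ (by positivity) |>.2
      rw [mul_pow, mul_pow, Real.sq_sqrt (by positivity), Real.sq_sqrt (by positivity)]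
      nlinarith
    linarith

theorem sum_betaSeq_pos {k : ℕ} (hk : 1 ≤ k) : 0 < ∑ t ∈ Finset.Icc 1 k, betaSeq t := by
  have hk' : (0 : ℝ) < k := by exact_mod_cast hk
  exact lt_of_lt_of_le (by positivity) (le_sum_betaSeq k)

theorem sum_betaSeq_sq_le (k : ℕ) : ∑ t ∈ Finset.range (k + 1), betaSeq t ^ 2 ≤ (k : ℝ) ^ 2 := by
  induction k with
  | zero => simp [betaSeq]
  | succ k ih =>
    rw [Finset.sum_range_succ, betaSeq_sq]
    push_cast
    nlinarith [(Nat.cast_nonneg k : (0 : ℝ) ≤ k)]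

/-- The averaging weights `θ_t = β_t / ∑_{j=1}^{k} β_j`. -/
noncomputable def weight (k t : ℕ) : ℝ := betaSeq t / ∑ j ∈ Finset.Icc 1 k, betaSeq j

theorem weight_nonneg (k t : ℕ) : 0 ≤ weight k t :=
  div_nonneg (betaSeq_nonneg t) (Finset.sum_nonneg fun j _ => betaSeq_nonneg j)

theorem weight_zero (k : ℕ) : weight k 0 = 0 := by simp [weight, betaSeq_zero]

theorem sum_weight {k : ℕ} (hk : 1 ≤ k) : ∑ t ∈ Finset.Icc 1 k, weight k t = 1 := by
  simp only [weight, ← Finset.sum_div]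
  exact div_self (sum_betaSeq_pos hk).ne'

/-- The squares of the `β_t` sum to at most `k²`, and the square of their sum is at least `4k³ / 9`.
-/
theorem sum_weight_sq_le {k : ℕ} (hk : 1 ≤ k) :
    ∑ t ∈ Finset.range (k + 1), weight k t ^ 2 ≤ 9 / (4 * k) := by
  have hk' : (0 : ℝ) < k := by exact_mod_cast hk
  have hB := sum_betaSeq_pos hk
  simp only [weight, div_pow, ← Finset.sum_div]
  rw [div_le_div_iff₀ (by positivity) (by positivity)]
  have h2 : (2 / 3 * (k * √(k : ℝ))) ^ 2 ≤ (∑ t ∈ Finset.Icc 1 k, betaSeq t) ^ 2 :=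
    pow_le_pow_left₀ (by positivity) (le_sum_betaSeq k) 2
  rw [mul_pow, mul_pow, Real.sq_sqrt hk'.le] at h2
  have := mul_le_mul_of_nonneg_right (sum_betaSeq_sq_le k) (by positivity : (0 : ℝ) ≤ 4 * k)
  nlinarith

end Weights

theorem measureReal_weighted_sum_ge_le {Ω E : Type*} [MeasurableSpace Ω] {P : Measure Ω}
    [IsProbabilityMeasure P] [Finite E] [MeasurableSpace E] [DiscreteMeasurableSpace E]
    {Y : ℕ → Ω → E} (hY : ∀ n, Measurable (Y n))
    (h : ∀ n, IndepFun (fun ω (i : Fin n) => Y i ω) (Y n) P) {X : ℕ → Ω → E → ℝ}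
    (hX : ∀ n ω ω', (∀ r < n, Y r ω = Y r ω') → X n ω = X n ω') {b : ℝ} (hb0 : 0 < b)
    (hb : ∀ n ω e, |X n ω e| ≤ b) (hmean : ∀ n ω, ∫ ω', X n ω (Y n ω') ∂P = 0)
    {k : ℕ} (hk : 1 ≤ k) {δ : ℝ} (hδ0 : 0 < δ) (hδ1 : δ ≤ 1) :
    P.real {ω | 3 * b / √(k : ℝ) * √(Real.log (1 / δ)) ≤
      ∑ t ∈ Finset.Icc 1 k, weight k t * X t ω (Y t ω)} ≤ δ := by
  have hk' : (0 : ℝ) < k := by exact_mod_cast hk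
  have hL : 0 ≤ Real.log (1 / δ) := Real.log_nonneg (by rw [le_div_iff₀ hδ0]; linarith)
  have hcoe : ∀ t, ((weight k t * b).toNNReal : ℝ) = weight k t * b := fun t =>
    Real.coe_toNNReal _ (mul_nonneg (weight_nonneg k t) hb0.le)
  have hs := hasSubgaussianMGF_sum_of_indepFun (P := P) hY h
    (G := fun t ω e => weight k t * X t ω e)
    (fun n ω ω' hω => by simp only [hX n ω ω' hω])
    (b := fun t => (weight k t * b).toNNReal)
    (fun n ω e => by
      rw [hcoe, abs_mul, abs_of_nonneg (weight_nonneg k n)]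
      exact mul_le_mul_of_nonneg_left (hb n ω e) (weight_nonneg k n))
    (fun n ω => by rw [integral_const_mul, hmean, mul_zero]) (k + 1)
  have ht := hs.measure_ge_le (ε := 3 * b / √(k : ℝ) * √(Real.log (1 / δ))) (by positivity)
  -- The martingale starts at `t = 0`, but that term has weight zero.
  simp only [sum_range_succ_eq_sum_Icc
    (f := fun t => weight k t * X t _ (Y t _)) (by simp [weight_zero])] at ht
  refine ht.trans ?_
  simp only [NNReal.coe_sum, NNReal.coe_pow, hcoe, mul_pow, ← Finset.sum_mul]
  set c := ∑ t ∈ Finset.range (k + 1), weight k t ^ 2 with hc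
  have hc1 : c ≤ 9 / (4 * k) := sum_weight_sq_le hk
  have hc0 : 0 < c := by
    have h1 : 0 < weight k 1 :=
      div_pos (by simp [betaSeq]) (sum_betaSeq_pos hk)
    exact (pow_pos h1 2).trans_le (Finset.single_le_sum (f := fun t => weight k t ^ 2)
      (fun t _ => sq_nonneg _) (Finset.mem_range.2 (by omega)))
  rw [div_pow, Real.sq_sqrt hL, Real.sq_sqrt hk'.le]
  -- With `c ≤ 9 / (4k)` the factor of the logarithm on the right is at least 2, so the constant 3
  -- leaves room.
  have hkey : Real.log (1 / δ) ≤ (3 * b) ^ 2 / k * Real.log (1 / δ) / (2 * (c * b ^ 2)) := by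
    rw [le_div_iff₀ (by positivity), mul_comm]
    refine mul_le_mul_of_nonneg_right ?_ hL
    rw [le_div_iff₀ hk']
    rw [le_div_iff₀ (by positivity)] at hc1
    nlinarith [sq_nonneg b]
  calc Real.exp _ ≤ Real.exp (-Real.log (1 / δ)) := by
        refine Real.exp_le_exp.2 ?_
        rw [neg_div]
        exact neg_le_neg hkey
    _ = δ := by rw [Real.exp_neg, Real.exp_log (by positivity), one_div, inv_inv]

/-! ### Stochastic matrices and discounted occupancy measures -/

section Stochastic

variable {S : Type*} [Fintype S] [DecidableEq S]

open Matrix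

theorem le_mulVec_of_mem_rowStochastic {P : Matrix S S ℝ} (hP : P ∈ rowStochastic ℝ S) {v : S → ℝ}
    {x : ℝ} (hv : ∀ s, x ≤ v s) (s : S) : x ≤ (P *ᵥ v) s := by
  calc x = ∑ s', P s s' * x := by
        rw [← Finset.sum_mul, sum_row_of_mem_rowStochastic hP, one_mul]
    _ ≤ _ := Finset.sum_le_sum fun s' _ => mul_le_mul_of_nonneg_left (hv s') (hP.1 s s')

theorem mulVec_le_of_mem_rowStochastic {P : Matrix S S ℝ} (hP : P ∈ rowStochastic ℝ S) {v : S → ℝ}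
    {x : ℝ} (hv : ∀ s, v s ≤ x) (s : S) : (P *ᵥ v) s ≤ x := by
  calc (P *ᵥ v) s ≤ ∑ s', P s s' * x :=
        Finset.sum_le_sum fun s' _ => mul_le_mul_of_nonneg_left (hv s') (hP.1 s s')
    _ = x := by rw [← Finset.sum_mul, sum_row_of_mem_rowStochastic hP, one_mul]

/-- The discounted occupancy measures `∑ₜ γᵗ Pᵗ` of a chain. -/
noncomputable def occupancy (γ : ℝ) (P : Matrix S S ℝ) (s s' : S) : ℝ :=
  ∑' t : ℕ, γ ^ t * (P ^ t) s s'

variable {γ : ℝ} {P : Matrix S S ℝ}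

theorem summable_occupancy (hγ0 : 0 ≤ γ) (hγ1 : γ < 1) (hP : P ∈ rowStochastic ℝ S) (s s' : S) :
    Summable fun t : ℕ => γ ^ t * (P ^ t) s s' := by
  refine Summable.of_nonneg_of_le (fun t => mul_nonneg (pow_nonneg hγ0 t) ((pow_mem hP t).1 s s'))
    (fun t => ?_) (summable_geometric_of_lt_one hγ0 hγ1)
  exact mul_le_of_le_one_right (pow_nonneg hγ0 t) (le_one_of_mem_rowStochastic (pow_mem hP t))

theorem occupancy_nonneg (hγ0 : 0 ≤ γ) (hP : P ∈ rowStochastic ℝ S) (s s' : S) :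
    0 ≤ occupancy γ P s s' :=
  tsum_nonneg fun t => mul_nonneg (pow_nonneg hγ0 t) ((pow_mem hP t).1 s s')

theorem hasSum_occupancy (hγ0 : 0 ≤ γ) (hγ1 : γ < 1) (hP : P ∈ rowStochastic ℝ S) (g : S → ℝ)
    (s : S) : HasSum (fun t : ℕ => γ ^ t * ((P ^ t) *ᵥ g) s) (∑ s', occupancy γ P s s' * g s') := by
  have h := hasSum_sum (s := Finset.univ) fun (s' : S) _ =>
    ((summable_occupancy hγ0 hγ1 hP s s').hasSum.mul_right (g s'))
  simpa only [occupancy, mulVec, dotProduct, Finset.mul_sum, mul_assoc] using h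

/-- The solution of the Bellman equation `u = g + γ P u`. -/
theorem eq_sum_occupancy (hγ0 : 0 ≤ γ) (hγ1 : γ < 1) (hP : P ∈ rowStochastic ℝ S) {u g : S → ℝ}
    (hu : ∀ s, u s = g s + γ * (P *ᵥ u) s) (s : S) : u s = ∑ s', occupancy γ P s s' * g s' := by
  -- Substituting `g = u - γ P u` makes the partial sums telescope; the remainder vanishes since `u`
  -- is bounded.
  have hpart : ∀ N : ℕ, ∑ t ∈ Finset.range N, γ ^ t * ((P ^ t) *ᵥ g) s =
      u s - γ ^ N * ((P ^ N) *ᵥ u) s := by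
    intro N
    induction N with
    | zero => simp
    | succ N ih =>
      have hg : g = u - γ • (P *ᵥ u) := by
        ext s'
        simp only [Pi.sub_apply, Pi.smul_apply, smul_eq_mul]
        linarith [hu s']
      rw [Finset.sum_range_succ, ih, pow_succ P, ← mulVec_mulVec, hg, mulVec_sub, mulVec_smul]
      simp only [Pi.sub_apply, Pi.smul_apply, smul_eq_mul]
      ring
  obtain ⟨C, hC⟩ := (Set.finite_range fun x => |u x|).bddAbove
  have hC' : ∀ x, |u x| ≤ C := fun x => hC ⟨x, rfl⟩
  have h0 : Filter.Tendsto (fun N : ℕ => γ ^ N * ((P ^ N) *ᵥ u) s) Filter.atTop (nhds 0) := by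
    refine squeeze_zero_norm (a := fun N => γ ^ N * C) (fun N => ?_) ?_
    · rw [norm_mul, Real.norm_of_nonneg (pow_nonneg hγ0 N)]
      refine mul_le_mul_of_nonneg_left (abs_le.2 ⟨?_, ?_⟩) (pow_nonneg hγ0 N)
      · exact le_mulVec_of_mem_rowStochastic (pow_mem hP N) (fun x => (abs_le.1 (hC' x)).1) s
      · exact mulVec_le_of_mem_rowStochastic (pow_mem hP N) (fun x => (abs_le.1 (hC' x)).2) s
    · simpa using (tendsto_pow_atTop_nhds_zero_of_lt_one hγ0 hγ1).mul_const C
  have h1 := (hasSum_occupancy hγ0 hγ1 hP g s).tendsto_sum_nat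
  simp only [hpart] at h1
  have h2 := (tendsto_const_nhds (x := u s)).sub h0
  rw [sub_zero] at h2
  exact tendsto_nhds_unique h2 h1

/-- The constant function `1 / (1 - γ)` solves the Bellman equation with unit cost. -/
theorem sum_occupancy (hγ0 : 0 ≤ γ) (hγ1 : γ < 1) (hP : P ∈ rowStochastic ℝ S) (s : S) :
    ∑ s', occupancy γ P s s' = 1 / (1 - γ) := by
  have h1 : 1 - γ ≠ 0 := by linarith
  have h := eq_sum_occupancy hγ0 hγ1 hP (u := fun _ => 1 / (1 - γ)) (g := fun _ => 1) (fun s => by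
    simp only [mulVec, dotProduct, ← Finset.sum_mul, sum_row_of_mem_rowStochastic hP]
    field_simp
    ring) s
  simpa using h.symm

end Stochastic

/-! ### Nature's Markov decision process -/

namespace Problem

open Matrix

variable {S A : Type*} [Fintype S] [Fintype A] (M : Problem S A)

/-- The transition matrix `P^π` of nature's MDP. -/
noncomputable abbrev natureChain (π : S → A → S → ℝ) : Matrix S S ℝ := M.chain (M.kernelOf π)

theorem natureChain_apply (π : S → A → S → ℝ) (s s' : S) :
    M.natureChain π s s' = (1 - M.ζ) * ∑ a, M.ϑ s a * M.Pbar s a s' +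
      M.ζ * ∑ a, M.ϑ s a * π s a s' := by
  simp only [natureChain, chain, kernelOf, of_apply, Pi.add_apply, Pi.smul_apply, smul_eq_mul,
    Finset.mul_sum, ← Finset.sum_add_distrib]
  exact Finset.sum_congr rfl fun a _ => by ring

theorem one_sub_ζ_nonneg : 0 ≤ 1 - M.ζ := by linarith [M.ζ_mem.2]

theorem one_sub_γ_pos : 0 < 1 - M.γ := by linarith [M.γ_lt_one]

theorem mixture_nonneg {s : S} {D : A → S → ℝ} (hD : D ∈ simplexFamily S A) (s' : S) :
    0 ≤ ∑ a, M.ϑ s a * D a s' :=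
  Finset.sum_nonneg fun a _ => mul_nonneg ((M.ϑ_mem s).1 a) ((hD a).1 s')

theorem sum_mixture {s : S} {D : A → S → ℝ} (hD : D ∈ simplexFamily S A) :
    ∑ s', ∑ a, M.ϑ s a * D a s' = 1 := by
  rw [Finset.sum_comm]
  simp only [← Finset.mul_sum, (hD _).2, mul_one, (M.ϑ_mem s).2]

theorem natureCost_mem (s : S) : M.natureCost s ∈ Set.Icc (-1 : ℝ) 0 := by
  have h0 : 0 ≤ ∑ a, M.ϑ s a * M.c s a :=
    Finset.sum_nonneg fun a _ => mul_nonneg ((M.ϑ_mem s).1 a) (M.c_mem s a).1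
  have h1 : ∑ a, M.ϑ s a * M.c s a ≤ ∑ a, M.ϑ s a :=
    Finset.sum_le_sum fun a _ => mul_le_of_le_one_right ((M.ϑ_mem s).1 a) (M.c_mem s a).2
  rw [(M.ϑ_mem s).2] at h1
  simp only [natureCost, Set.mem_Icc]
  constructor <;> linarith

theorem sum_geometric_mem {x : ℕ → ℝ} (hx : ∀ i, x i ∈ Set.Icc (-1 : ℝ) 0) (N : ℕ) :
    ∑ i ∈ Finset.range N, M.γ ^ i * x i ∈ Set.Icc (-(1 / (1 - M.γ))) 0 := by
  have hgeo : ∑ i ∈ Finset.range N, M.γ ^ i ≤ 1 / (1 - M.γ) := by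
    rw [one_div, ← tsum_geometric_of_lt_one M.γ_nonneg M.γ_lt_one]
    exact (summable_geometric_of_lt_one M.γ_nonneg M.γ_lt_one).sum_le_tsum _
      fun i _ => pow_nonneg M.γ_nonneg i
  constructor
  · refine (neg_le_neg hgeo).trans ?_
    rw [← Finset.sum_neg_distrib]
    refine Finset.sum_le_sum fun i _ => ?_
    nlinarith [mul_le_mul_of_nonneg_left (hx i).1 (pow_nonneg M.γ_nonneg i)]
  · exact Finset.sum_nonpos fun i _ =>
      mul_nonpos_of_nonneg_of_nonpos (pow_nonneg M.γ_nonneg i) (hx i).2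

variable {M} in
theorem mem_simplexFamily_of_mem_policies {π : S → A → S → ℝ} (hπ : π ∈ M.policies) (s : S) :
    π s ∈ simplexFamily S A := M.D_subset s (hπ s)

variable [DecidableEq S]

theorem natureChain_mem_rowStochastic {π : S → A → S → ℝ} (hπ : π ∈ M.policies) :
    M.natureChain π ∈ rowStochastic ℝ S := by
  rw [mem_rowStochastic_iff_sum]
  refine ⟨fun s s' => ?_, fun s => ?_⟩
  · rw [natureChain_apply]
    exact add_nonneg (mul_nonneg M.one_sub_ζ_nonneg (M.mixture_nonneg (M.Pbar_mem s) s'))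
      (mul_nonneg M.ζ_mem.1 (M.mixture_nonneg (mem_simplexFamily_of_mem_policies hπ s) s'))
  · simp only [natureChain_apply, Finset.sum_add_distrib, ← Finset.mul_sum (a := M.ζ),
      ← Finset.mul_sum (a := 1 - M.ζ), M.sum_mixture (M.Pbar_mem s),
      M.sum_mixture (mem_simplexFamily_of_mem_policies hπ s)]
    ring

/-- The expectation `∑_{i=0}^{l} γ^i (P^π)^i ℭ` of the `l`-step estimate of `𝒱^π`. -/
noncomputable def truncatedValue (l : ℕ) (π : S → A → S → ℝ) (s : S) : ℝ :=
  ∑ i ∈ Finset.range (l + 1), M.γ ^ i * ((M.natureChain π ^ i) *ᵥ M.natureCost) s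

theorem mulVec_natureCost_mem {P : Matrix S S ℝ} (hP : P ∈ rowStochastic ℝ S) (s : S) :
    (P *ᵥ M.natureCost) s ∈ Set.Icc (-1 : ℝ) 0 :=
  ⟨le_mulVec_of_mem_rowStochastic hP (fun s => (M.natureCost_mem s).1) s,
    mulVec_le_of_mem_rowStochastic hP (fun s => (M.natureCost_mem s).2) s⟩

variable {M}
variable {π π' : S → A → S → ℝ}

theorem truncatedValue_mem (hπ : π ∈ M.policies) (l : ℕ) (s : S) :
    M.truncatedValue l π s ∈ Set.Icc (-(1 / (1 - M.γ))) 0 :=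
  M.sum_geometric_mem
    (fun i => M.mulVec_natureCost_mem (pow_mem (M.natureChain_mem_rowStochastic hπ) i) s) _

theorem hasSum_natureValue (hπ : π ∈ M.policies) (s : S) :
    HasSum (fun t : ℕ => M.γ ^ t * ((M.natureChain π ^ t) *ᵥ M.natureCost) s)
      (M.natureValue π s) :=
  (hasSum_occupancy M.γ_nonneg M.γ_lt_one (M.natureChain_mem_rowStochastic hπ)
    M.natureCost s).summable.hasSum

theorem natureValue_bellman (hπ : π ∈ M.policies) (s : S) :
    M.natureValue π s = M.natureCost s + M.γ * (M.natureChain π *ᵥ M.natureValue π) s := by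
  have h1 := (hasSum_nat_add_iff' 1).2 (hasSum_natureValue hπ s)
  have h2 := (hasSum_sum (s := Finset.univ) fun (s' : S) _ =>
    (hasSum_natureValue hπ s').mul_left (M.natureChain π s s')).mul_left M.γ
  have h3 := h1.unique (h2.congr_fun ?_)
  · simp only [Finset.range_one, Finset.sum_singleton, pow_zero, one_mul, one_mulVec] at h3
    simp only [mulVec, dotProduct] at h3 ⊢
    linarith
  · intro t
    rw [pow_succ' (M.natureChain π), ← mulVec_mulVec]
    simp only [mulVec, dotProduct, Finset.mul_sum]
    refine Finset.sum_congr rfl fun s' _ => Finset.sum_congr rfl fun s'' _ => ?_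
    ring

/-- The difference is minus the tail of a series of nonpositive terms. Its sign keeps the bias out
of the lower error bound. -/
theorem truncatedValue_sub_natureValue_mem (hπ : π ∈ M.policies) (l : ℕ) (s : S) :
    M.truncatedValue l π s - M.natureValue π s ∈ Set.Icc 0 (M.γ ^ l / (1 - M.γ)) := by
  have h1 := (hasSum_nat_add_iff' (l + 1)).2 (hasSum_natureValue hπ s)
  have h2 := ((hasSum_geometric_of_lt_one M.γ_nonneg M.γ_lt_one).mul_left (M.γ ^ (l + 1))).neg
  have hm := fun i =>
    M.mulVec_natureCost_mem (pow_mem (M.natureChain_mem_rowStochastic hπ) i) s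
  have hle := hasSum_le (fun t => ?_) h2 h1
  · have h3 := h1.nonpos fun t =>
      mul_nonpos_of_nonneg_of_nonpos (pow_nonneg M.γ_nonneg _) (hm _).2
    have hγ : M.γ ^ (l + 1) * (1 - M.γ)⁻¹ ≤ M.γ ^ l / (1 - M.γ) := by
      rw [← div_eq_mul_inv]
      exact div_le_div_of_nonneg_right
        (pow_le_pow_of_le_one M.γ_nonneg M.γ_lt_one.le (Nat.le_succ l)) M.one_sub_γ_pos.le
    simp only [truncatedValue]
    constructor <;> linarith
  · have := mul_le_mul_of_nonneg_left (hm (t + (l + 1))).1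
      (pow_nonneg M.γ_nonneg (t + (l + 1)))
    rw [pow_add M.γ t (l + 1)] at this ⊢
    linarith

theorem natureValue_mem (hπ : π ∈ M.policies) (s : S) :
    M.natureValue π s ∈ Set.Icc (-(1 / (1 - M.γ))) 0 := by
  have h := fun t : ℕ => M.sum_geometric_mem (fun i =>
    M.mulVec_natureCost_mem (pow_mem (M.natureChain_mem_rowStochastic hπ) i) s) t
  have ht := (hasSum_natureValue hπ s).tendsto_sum_nat
  exact isClosed_Icc.mem_of_tendsto ht (Filter.Eventually.of_forall h)

theorem natureOptValue_le (hπ : π ∈ M.policies) (s : S) : M.natureOptValue s ≤ M.natureValue π s :=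
  ciInf_le (f := fun π : M.policies => M.natureValue π s)
    ⟨-(1 / (1 - M.γ)), by rintro _ ⟨π, rfl⟩; exact (natureValue_mem π.2 s).1⟩ ⟨π, hπ⟩

/-- The sets `𝒟ₛ` need not be closed, so an optimal policy may fail to exist; a nearly optimal one
replaces it as comparator. -/
theorem exists_natureValue_lt {η : ℝ} (hη : 0 < η) (s : S) :
    ∃ π ∈ M.policies, M.natureValue π s < M.natureOptValue s + η := by
  choose π hπ using M.D_nonempty
  have : Nonempty M.policies := ⟨⟨π, hπ⟩⟩
  obtain ⟨π, h⟩ := exists_lt_of_ciInf_lt (f := fun π : M.policies => M.natureValue π s)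
    (lt_add_of_pos_right (M.natureOptValue s) hη)
  exact ⟨π, π.2, h⟩

variable (M) in
/-- The pairing `∑ₐ ϑ(a|s) ⟨Dₐ, v⟩`. -/
noncomputable def pairing (s : S) (D : A → S → ℝ) (v : S → ℝ) : ℝ :=
  ∑ a, ∑ s', D a s' * (M.ϑ s a * v s')

/-- The performance difference lemma. -/
theorem natureValue_sub_natureValue (hπ : π ∈ M.policies) (hπ' : π' ∈ M.policies) (s : S) :
    M.natureValue π' s - M.natureValue π s =
      ∑ s', occupancy M.γ (M.natureChain π) s s' *
        (M.γ * M.ζ * M.pairing s' (π' s' - π s') (M.natureValue π')) := by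
  refine eq_sum_occupancy M.γ_nonneg M.γ_lt_one (M.natureChain_mem_rowStochastic hπ)
    (u := fun s => M.natureValue π' s - M.natureValue π s) (fun s => ?_) s
  -- The nominal parts of the two chains cancel. Subtracting the Bellman equations shows that the
  -- difference of values solves the Bellman equation of `π` with cost `γ (P^π' - P^π) 𝒱^π'`.
  have hp : M.ζ * M.pairing s (π' s - π s) (M.natureValue π') =
      (M.natureChain π' *ᵥ M.natureValue π') s - (M.natureChain π *ᵥ M.natureValue π') s := by
    simp only [mulVec, dotProduct, natureChain_apply, pairing, ← Finset.sum_sub_distrib]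
    rw [Finset.sum_comm, Finset.mul_sum]
    refine Finset.sum_congr rfl fun s' _ => ?_
    have : ∑ a, (π' s - π s) a s' * (M.ϑ s a * M.natureValue π' s') =
        (∑ a, M.ϑ s a * π' s a s' - ∑ a, M.ϑ s a * π s a s') * M.natureValue π' s' := by
      rw [← Finset.sum_sub_distrib, Finset.sum_mul]
      exact Finset.sum_congr rfl fun a _ => by simp only [Pi.sub_apply]; ring
    rw [this]
    ring
  have hs : (M.natureChain π *ᵥ fun s => M.natureValue π' s - M.natureValue π s) s =
      (M.natureChain π *ᵥ M.natureValue π') s - (M.natureChain π *ᵥ M.natureValue π) s := by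
    rw [← Pi.sub_apply, ← mulVec_sub]; rfl
  rw [mul_assoc, hp, hs]
  linarith [natureValue_bellman hπ s, natureValue_bellman hπ' s]

end Problem

open Matrix

/-! ### The simulator-based estimate for fixed samples -/

namespace Problem

variable {S A : Type*} [Fintype S] [Fintype A] [DecidableEq S] {M : Problem S A}
  {π : S → A → S → ℝ}

theorem seMatrix_mem_rowStochastic (hπ : π ∈ M.policies) (x : S → S) :
    M.seMatrix π x ∈ rowStochastic ℝ S := by
  rw [mem_rowStochastic_iff_sum]
  refine ⟨fun s s' => ?_, fun s => ?_⟩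
  · exact add_nonneg (mul_nonneg M.one_sub_ζ_nonneg (by split_ifs <;> norm_num))
      (mul_nonneg M.ζ_mem.1 (M.mixture_nonneg (mem_simplexFamily_of_mem_policies hπ s) s'))
  · simp only [seMatrix, of_apply, Finset.sum_add_distrib, ← Finset.mul_sum (a := M.ζ),
      ← Finset.mul_sum (a := 1 - M.ζ),
      M.sum_mixture (mem_simplexFamily_of_mem_policies hπ s), Finset.sum_ite_eq,
      Finset.mem_univ, if_true]
    ring

theorem seProd_mem_rowStochastic (hπ : π ∈ M.policies) (x : ℕ → S → S) (i : ℕ) :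
    M.seProd π x i ∈ rowStochastic ℝ S := by
  induction i with
  | zero => exact one_mem _
  | succ i ih => exact mul_mem ih (seMatrix_mem_rowStochastic hπ _)

theorem seProd_congr {x y : ℕ → S → S} {i : ℕ} (h : ∀ j < i, x j = y j) :
    M.seProd π x i = M.seProd π y i := by
  induction i with
  | zero => rfl
  | succ i ih =>
    simp only [seProd, ih fun j hj => h j (hj.trans (Nat.lt_succ_self i)), h i (Nat.lt_succ_self i)]

/-- Although `l + 1` terms are summed, `R_i` uses only the batches `j < i`, so batch `l` is never
read. -/
theorem seEstimate_congr {x y : ℕ → S → S} {l : ℕ} (h : ∀ j < l, x j = y j) :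
    M.seEstimate l π x = M.seEstimate l π y := by
  ext s
  refine Finset.sum_congr rfl fun i hi => ?_
  rw [seProd_congr fun j hj => h j (by have := Finset.mem_range.1 hi; omega)]

theorem seEstimate_mem (hπ : π ∈ M.policies) (l : ℕ) (x : ℕ → S → S) (s : S) :
    M.seEstimate l π x s ∈ Set.Icc (-(1 / (1 - M.γ))) 0 :=
  M.sum_geometric_mem
    (fun i => M.mulVec_natureCost_mem (seProd_mem_rowStochastic hπ x i) s) _

end Problem

/-! ### Independence of the samples and unbiasedness -/

namespace Run

variable {S A Ω : Type*} [Fintype S] [DecidableEq S] [Fintype A] [MeasurableSpace Ω]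
  {Pr : Measure Ω} {M : Problem S A} {w : S → (A → S → ℝ) → ℝ} {β lam : ℕ → ℝ}
  {l : ℕ} (R : Run M w β lam l Pr)

/-- The random variable `U` is determined by the samples with index in `I`. -/
def IsDetermined {F : Type*} (I : Finset (ℕ × ℕ × S)) (U : Ω → F) : Prop :=
  ∀ ω ω', (∀ j ∈ I, R.ξ j.1 j.2.1 j.2.2 ω = R.ξ j.1 j.2.1 j.2.2 ω') → U ω = U ω'

variable {R} {I J : Finset (ℕ × ℕ × S)}

/-- Finitely many samples with values in a finite set form a discrete random vector. Any function of
it is measurable for every σ-algebra on the target, which yields measurability, integrability and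
independence below. -/
theorem exists_eq_comp {F : Type*} [Nonempty F] {U : Ω → F} (hU : R.IsDetermined I U) :
    ∃ e : (I → A × S) → F, U = fun ω => e fun j => R.ξ j.1.1 j.1.2.1 j.1.2.2 ω := by
  obtain ⟨e, he⟩ := (Function.factorsThrough_iff
    (f := fun ω (j : I) => R.ξ j.1.1 j.1.2.1 j.1.2.2 ω) U).1
    fun ω ω' h => hU ω ω' fun j hj => congrFun h ⟨j, hj⟩
  exact ⟨e, he⟩

variable {F E : Type*} [MeasurableSpace F] [MeasurableSpace E]

theorem measurable_ξ (t i : ℕ) (s : S) : Measurable[_, ⊤] (R.ξ t i s) := by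
  let _ : MeasurableSpace (A × S) := ⊤
  exact measurable_to_countable' fun z => R.measurableSet_ξ t i s z

theorem measurable_of_isDetermined [Nonempty F] {U : Ω → F} (hU : R.IsDetermined I U) :
    Measurable U := by
  let _ : MeasurableSpace (A × S) := ⊤
  have : DiscreteMeasurableSpace (A × S) := ⟨fun _ => trivial⟩
  obtain ⟨e, rfl⟩ := exists_eq_comp hU
  exact Measurable.of_discrete.comp (measurable_pi_lambda _ fun j => measurable_ξ _ _ _)

theorem integrable_of_isDetermined [IsProbabilityMeasure Pr] {U : Ω → ℝ}
    (hU : R.IsDetermined I U) : Integrable U Pr := by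
  obtain ⟨e, he⟩ := exists_eq_comp hU
  obtain ⟨C, hC⟩ := (Set.finite_range fun x => ‖e x‖).bddAbove
  refine Integrable.of_bound (measurable_of_isDetermined hU).aestronglyMeasurable C
    (Filter.Eventually.of_forall fun ω => ?_)
  rw [he]
  exact hC ⟨_, rfl⟩

theorem indepFun_of_isDetermined [Nonempty F] [Nonempty E] (hIJ : Disjoint I J) {U : Ω → F}
    {V : Ω → E} (hU : R.IsDetermined I U) (hV : R.IsDetermined J V) : IndepFun U V Pr := by
  let _ : MeasurableSpace (A × S) := ⊤
  have : DiscreteMeasurableSpace (A × S) := ⟨fun _ => trivial⟩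
  obtain ⟨e, rfl⟩ := exists_eq_comp hU
  obtain ⟨f, rfl⟩ := exists_eq_comp hV
  exact (R.indep_ξ.indepFun_finset I J hIJ fun j => measurable_ξ _ _ _).comp
    (φ := e) (ψ := f) Measurable.of_discrete Measurable.of_discrete

/-- The next states sampled in iteration `t`. -/
def nextState (R : Run M w β lam l Pr) (t : ℕ) (ω : Ω) (i : ℕ) (s : S) : S := (R.ξ t i s ω).2

theorem integral_nextState [IsProbabilityMeasure Pr] (t i : ℕ) (s s' : S) :
    ∫ ω, (if R.nextState t ω i s = s' then (1 : ℝ) else 0) ∂Pr =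
      ∑ a, M.ϑ s a * M.Pbar s a s' := by
  classical
  have h : ∀ ω, (if R.nextState t ω i s = s' then (1 : ℝ) else 0) =
      ∑ a, {ω | R.ξ t i s ω = (a, s')}.indicator (fun _ => (1 : ℝ)) ω := by
    intro ω
    simp only [Set.indicator_apply, Set.mem_ofPred_eq, Prod.ext_iff, nextState]
    by_cases h : (R.ξ t i s ω).2 = s' <;> simp [h]
  simp only [h]
  rw [integral_finsetSum _ fun a _ =>
    (integrable_const (1 : ℝ)).indicator (R.measurableSet_ξ t i s (a, s'))]
  refine Finset.sum_congr rfl fun a _ => ?_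
  rw [integral_indicator_const _ (R.measurableSet_ξ t i s (a, s')), R.law_ξ, smul_eq_mul, mul_one]

variable {π : S → A → S → ℝ}

theorem isDetermined_nextState (t i : ℕ) :
    R.IsDetermined ({t} ×ˢ {i} ×ˢ Finset.univ) fun ω => R.nextState t ω i := by
  intro ω ω' h
  ext s
  simp only [nextState, h (t, i, s) (by simp)]

theorem isDetermined_seProd (t i : ℕ) :
    R.IsDetermined ({t} ×ˢ Finset.range i ×ˢ Finset.univ)
      fun ω => M.seProd π (R.nextState t ω) i := by
  intro ω ω' h
  refine Problem.seProd_congr fun j hj => funext fun s => ?_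
  simp only [nextState, h (t, j, s) (by simp [hj])]

theorem integral_seMatrix [IsProbabilityMeasure Pr] (t i : ℕ) (s s' : S) :
    ∫ ω, M.seMatrix π (R.nextState t ω i) s s' ∂Pr = M.natureChain π s s' := by
  have hd : R.IsDetermined ({t} ×ˢ {i} ×ˢ Finset.univ)
      fun ω => (1 - M.ζ) * (if R.nextState t ω i s = s' then (1 : ℝ) else 0) :=
    fun ω ω' h => by simp only [isDetermined_nextState t i ω ω' h]
  simp only [Problem.seMatrix, of_apply]
  rw [integral_add (integrable_of_isDetermined hd) (integrable_const _), integral_const_mul,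
    integral_nextState, Problem.natureChain_apply]
  simp

/-- `R_i` uses the batches before `i` and the next factor uses batch `i`. By independence, the
expectation of the matrix product is the product of the expectations. The policy is fixed here. -/
theorem integral_seProd [IsProbabilityMeasure Pr] (t i : ℕ) (s s' : S) :
    ∫ ω, M.seProd π (R.nextState t ω) i s s' ∂Pr = (M.natureChain π ^ i) s s' := by
  induction i generalizing s' with
  | zero => simp [Problem.seProd]
  | succ i ih =>
    have h1 : ∀ u, R.IsDetermined ({t} ×ˢ Finset.range i ×ˢ Finset.univ)
        fun ω => M.seProd π (R.nextState t ω) i s u :=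
      fun u ω ω' h => by simp only [isDetermined_seProd (π := π) t i ω ω' h]
    have h2 : ∀ u, R.IsDetermined ({t} ×ˢ {i} ×ˢ Finset.univ)
        fun ω => M.seMatrix π (R.nextState t ω i) u s' :=
      fun u ω ω' h => by simp only [isDetermined_nextState t i ω ω' h]
    have h3 : ∀ u, R.IsDetermined ({t} ×ˢ Finset.range (i + 1) ×ˢ Finset.univ)
        fun ω => M.seProd π (R.nextState t ω) i s u * M.seMatrix π (R.nextState t ω i) u s' := by
      intro u ω ω' h
      refine congrArg₂ (· * ·) (h1 u ω ω' fun j hj => h j ?_) (h2 u ω ω' fun j hj => h j ?_)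
      · simp only [Finset.mem_product, Finset.mem_singleton, Finset.mem_range,
          Finset.mem_univ, and_true] at hj ⊢
        omega
      · simp only [Finset.mem_product, Finset.mem_singleton, Finset.mem_range,
          Finset.mem_univ, and_true] at hj ⊢
        omega
    simp only [Problem.seProd, mul_apply, pow_succ]
    rw [integral_finsetSum _ fun u _ => integrable_of_isDetermined (h3 u)]
    refine Finset.sum_congr rfl fun u _ => ?_
    have hind := indepFun_of_isDetermined ?_ (h1 u) (h2 u)
    · rw [hind.integral_fun_mul_eq_mul_integral
        (measurable_of_isDetermined (h1 u)).aestronglyMeasurable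
        (measurable_of_isDetermined (h2 u)).aestronglyMeasurable, ih, integral_seMatrix]
    · rw [Finset.disjoint_left]
      rintro ⟨a, b, c⟩ h h'
      simp only [Finset.mem_product, Finset.mem_singleton, Finset.mem_range,
          Finset.mem_univ] at h h'
      omega

theorem integral_seEstimate [IsProbabilityMeasure Pr] (m t : ℕ) (s : S) :
    ∫ ω, M.seEstimate m π (R.nextState t ω) s ∂Pr = M.truncatedValue m π s := by
  have h : ∀ i s', R.IsDetermined ({t} ×ˢ Finset.range i ×ˢ Finset.univ)
      fun ω => M.γ ^ i * (M.seProd π (R.nextState t ω) i s s' * M.natureCost s') :=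
    fun i s' ω ω' h => by simp only [isDetermined_seProd (π := π) t i ω ω' h]
  simp only [Problem.seEstimate, Problem.truncatedValue, mulVec, dotProduct, Finset.mul_sum]
  rw [integral_finsetSum _ fun i _ =>
    integrable_finsetSum _ fun s' _ => integrable_of_isDetermined (h i s')]
  refine Finset.sum_congr rfl fun i _ => ?_
  rw [integral_finsetSum _ fun s' _ => integrable_of_isDetermined (h i s')]
  refine Finset.sum_congr rfl fun s' _ => ?_
  rw [integral_const_mul, integral_mul_const, integral_seProd]

end Run

/-- A convex function on `[0, 1]` whose slopes at `0` are bounded below has a finite right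
derivative at `0`. -/
theorem exists_hasDerivWithinAt_of_convexOn {φ : ℝ → ℝ} (hφ : ConvexOn ℝ (Set.Icc 0 1) φ) {m : ℝ}
    (hm : ∀ τ ∈ Set.Ioo (0 : ℝ) 1, m ≤ slope φ 0 τ) :
    ∃ g, m ≤ g ∧ HasDerivWithinAt φ g (Set.Ici 0) 0 := by
  have hne : (Set.Ioo (0 : ℝ) 1).Nonempty := ⟨1 / 2, by norm_num, by norm_num⟩
  have hlb : m ∈ lowerBounds (slope φ 0 '' Set.Ioo 0 1) := by
    rintro _ ⟨τ, hτ, rfl⟩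
    exact hm τ hτ
  have hmono : MonotoneOn (slope φ 0) (Set.Ioo 0 1) :=
    (hφ.slope_mono (Set.left_mem_Icc.2 zero_le_one)).mono fun τ hτ =>
      ⟨Set.Ioo_subset_Icc_self hτ, hτ.1.ne'⟩
  refine ⟨sInf (slope φ 0 '' Set.Ioo 0 1), le_csInf (hne.image _) hlb, ?_⟩
  rw [hasDerivWithinAt_iff_tendsto_slope, Set.Ici_sdiff_left]
  exact hmono.tendsto_nhdsWithin_Ioo_right hne ⟨m, hlb⟩

theorem convexOn_segment {S A : Type*} [Fintype S]
    {w : S → (A → S → ℝ) → ℝ} {s : S} (hw : ConvexOn ℝ (simplexFamily S A) (w s)) {x y : A → S → ℝ}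
    (hx : x ∈ simplexFamily S A) (hy : y ∈ simplexFamily S A) :
    ConvexOn ℝ (Set.Icc 0 1) fun τ : ℝ => w s (x + τ • (y - x)) := by
  have h := (hw.comp_affineMap (AffineMap.lineMap x y)).subset (s := Set.Icc (0 : ℝ) 1)
    (fun τ hτ => hw.1.lineMap_mem hx hy hτ) (convex_Icc 0 1)
  refine h.congr fun τ _ => ?_
  simp [AffineMap.lineMap_apply, add_comm]

/-! ### Regret of dual averaging at one state -/

namespace Problem

variable {S A : Type*} [Fintype S] [Fintype A] {M : Problem S A} {w : S → (A → S → ℝ) → ℝ}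
  {wbar μ : ℝ}

variable (M) in
/-- The squared distance `∑ₐ ϑ(a|s) ‖Dₐ - D'ₐ‖₁²`. -/
noncomputable def sqDist (s : S) (D D' : A → S → ℝ) : ℝ :=
  ∑ a, M.ϑ s a * (∑ s', |D a s' - D' a s'|) ^ 2

theorem sqDist_nonneg (s : S) (D D' : A → S → ℝ) : 0 ≤ M.sqDist s D D' :=
  Finset.sum_nonneg fun a _ => mul_nonneg ((M.ϑ_mem s).1 a) (sq_nonneg _)

/-- Where the slopes along a segment are bounded below, the directional derivative is finite, so that
the lower bound on the Bregman divergence applies. -/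
theorem IsDGF.sqDist_le (hw : M.IsDGF w wbar μ) {s : S} {x y : A → S → ℝ}
    (hx : x ∈ simplexFamily S A) (hy : y ∈ simplexFamily S A) {m : ℝ}
    (hm : ∀ τ ∈ Set.Ioo (0 : ℝ) 1, τ * m ≤ w s (x + τ • (y - x)) - w s x) :
    μ / 2 * M.sqDist s x y ≤ w s y - w s x - m := by
  obtain ⟨g, hmg, hg⟩ := exists_hasDerivWithinAt_of_convexOn
    (convexOn_segment (hw.convexOn s) hx hy) (m := m) fun τ hτ => by
      rw [slope_def_field, le_div_iff₀ (by linarith [hτ.1])]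
      simpa [mul_comm] using hm τ hτ
  have := hw.bregman_ge s x hx y hy g hg
  simp only [sqDist]
  linarith

/-- Strong minimality of a minimizer of a linear function plus a multiple of a distance generating
function. -/
theorem IsDGF.le_of_isMinOn (hw : M.IsDGF w wbar μ) {s : S} {x y : A → S → ℝ} (hx : x ∈ M.D s)
    (hy : y ∈ M.D s) {L : (A → S → ℝ) → ℝ} {c : ℝ} (hc : 0 < c)
    (hL : ∀ τ : ℝ, L (x + τ • (y - x)) = L x + τ * (L y - L x))
    (hmin : IsMinOn (fun D => L D + c * w s D) (M.D s) x) :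
    L x + c * w s x + c * (μ / 2 * M.sqDist s x y) ≤ L y + c * w s y := by
  have h := hw.sqDist_le (M.D_subset s hx) (M.D_subset s hy) (m := (L x - L y) / c)
    fun τ hτ => by
      have hmem : x + τ • (y - x) ∈ M.D s := by
        have := (M.D_convex s).lineMap_mem hx hy (Set.Ioo_subset_Icc_self hτ)
        simpa [AffineMap.lineMap_apply, add_comm] using this
      have h1 := isMinOn_iff.1 hmin _ hmem
      simp only [hL] at h1
      rw [mul_div_assoc', div_le_iff₀ hc]
      linarith
  have h2 := mul_le_mul_of_nonneg_left h hc.le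
  have h3 : c * ((L x - L y) / c) = L x - L y := by field_simp
  linarith

theorem pairing_sub (s : S) (x y : A → S → ℝ) (v : S → ℝ) :
    M.pairing s (x - y) v = M.pairing s x v - M.pairing s y v := by
  simp only [pairing, Pi.sub_apply, sub_mul, Finset.sum_sub_distrib]

theorem pairing_add_smul (s : S) (x y : A → S → ℝ) (v : S → ℝ) (τ : ℝ) :
    M.pairing s (x + τ • y) v = M.pairing s x v + τ * M.pairing s y v := by
  simp only [pairing, Pi.add_apply, Pi.smul_apply, smul_eq_mul, add_mul, Finset.sum_add_distrib,
    Finset.mul_sum, mul_assoc]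

/-- Hölder's inequality for each action, then Cauchy–Schwarz for the probability weights `ϑ(·|s)`.
-/
theorem abs_pairing_sub_le (s : S) (x y : A → S → ℝ) {v : S → ℝ} {C : ℝ} (hC : 0 ≤ C)
    (hv : ∀ s, |v s| ≤ C) : |M.pairing s (x - y) v| ≤ C * √(M.sqDist s x y) := by
  have h1 : |M.pairing s (x - y) v| ≤ C * ∑ a, M.ϑ s a * ∑ s', |x a s' - y a s'| := by
    rw [Finset.mul_sum]
    refine (Finset.abs_sum_le_sum_abs _ _).trans (Finset.sum_le_sum fun a _ => ?_)
    rw [← mul_assoc, Finset.mul_sum]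
    refine (Finset.abs_sum_le_sum_abs _ _).trans (Finset.sum_le_sum fun s' _ => ?_)
    rw [abs_mul, abs_mul, abs_of_nonneg ((M.ϑ_mem s).1 a), Pi.sub_apply, Pi.sub_apply]
    have := mul_le_mul_of_nonneg_left (hv s')
      (mul_nonneg (abs_nonneg (x a s' - y a s')) ((M.ϑ_mem s).1 a))
    linarith
  refine h1.trans (mul_le_mul_of_nonneg_left (Real.le_sqrt_of_sq_le ?_) hC)
  have h2 := Finset.sum_sq_le_sum_mul_sum_of_sq_le_mul Finset.univ
    (r := fun a => M.ϑ s a * ∑ s', |x a s' - y a s'|) (f := fun a => M.ϑ s a)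
    (g := fun a => M.ϑ s a * (∑ s', |x a s' - y a s'|) ^ 2)
    (fun a _ => (M.ϑ_mem s).1 a) (fun a _ => mul_nonneg ((M.ϑ_mem s).1 a) (sq_nonneg _))
    (fun a _ => le_of_eq (by ring))
  rwa [(M.ϑ_mem s).2, one_mul] at h2

theorem abs_pairing_le (s : S) {x : A → S → ℝ} (hx : x ∈ simplexFamily S A) {v : S → ℝ} {C : ℝ}
    (hv : ∀ s, |v s| ≤ C) : |M.pairing s x v| ≤ C := by
  calc |M.pairing s x v| ≤ ∑ a, M.ϑ s a * C := by
        refine (Finset.abs_sum_le_sum_abs _ _).trans (Finset.sum_le_sum fun a _ => ?_)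
        calc |∑ s', x a s' * (M.ϑ s a * v s')| ≤ ∑ s', x a s' * (M.ϑ s a * C) := by
              refine (Finset.abs_sum_le_sum_abs _ _).trans (Finset.sum_le_sum fun s' _ => ?_)
              rw [abs_mul, abs_mul, abs_of_nonneg ((M.ϑ_mem s).1 a), abs_of_nonneg ((hx a).1 s')]
              exact mul_le_mul_of_nonneg_left
                (mul_le_mul_of_nonneg_left (hv s') ((M.ϑ_mem s).1 a)) ((hx a).1 s')
          _ = M.ϑ s a * C := by rw [← Finset.sum_mul, (hx a).2, one_mul]
    _ = C := by rw [← Finset.sum_mul, (M.ϑ_mem s).2, one_mul]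

theorem objective_eq (β lam : ℕ → ℝ) (V : ℕ → S → ℝ) (k : ℕ) (s : S) (D : A → S → ℝ) :
    M.objective w β lam V k s D =
      M.γ * M.ζ * (∑ t ∈ Finset.range (k + 1), β t * M.pairing s D (V t)) + lam k * w s D :=
  rfl

/-- The regret of the updates of the policy at the state `s`. -/
theorem IsDGF.regret_le (hw : M.IsDGF w wbar μ) (hwbar : 0 < wbar) (hμ : 0 < μ) {s : S}
    {V : ℕ → S → ℝ} (hV : ∀ t s, |V t s| ≤ 1 / (1 - M.γ)) {x : ℕ → A → S → ℝ}
    (hx : ∀ k, x (k + 1) ∈ M.D s)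
    (hmin : ∀ k, IsMinOn (M.objective w betaSeq (lamSeq M.γ M.ζ wbar μ) V k s) (M.D s) (x (k + 1)))
    {y : A → S → ℝ} (hy : y ∈ M.D s) (k : ℕ) :
    M.γ * M.ζ * ∑ t ∈ Finset.range (k + 1), betaSeq t * M.pairing s (x t - y) (V t) ≤
      (k + (k + 1) / 2) * (M.γ * M.ζ / (1 - M.γ) * (√(μ * wbar) / μ)) := by
  have hγ := M.one_sub_γ_pos
  -- If `γ ζ = 0`, both sides vanish; this case is separated because then `λ_k = 0` and the
  -- regularizer disappears.
  rcases (mul_nonneg M.γ_nonneg M.ζ_mem.1).eq_or_lt with h0 | h0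
  · simp [← h0]
  set q := √(μ * wbar) with hq
  have hq0 : 0 < q := Real.sqrt_pos.2 (mul_pos hμ hwbar)
  have hqq : q ^ 2 = μ * wbar := Real.sq_sqrt (mul_pos hμ hwbar).le
  set a := M.γ * M.ζ / (1 - M.γ) with ha
  have ha0 : 0 < a := div_pos h0 hγ
  have hlam : ∀ k, lamSeq M.γ M.ζ wbar μ k = (k + 1) * (a / (2 * q)) := by
    intro k
    simp only [lamSeq, ha, ← hq]
    field_simp
  have hlam0 : ∀ k : ℕ, 0 < ((k : ℝ) + 1) * (a / (2 * q)) := fun k => by positivity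
  -- The minimum of the `k`-th objective is at least the loss incurred so far, up to `a q / μ` per
  -- round. The arbitrary initial policy costs nothing because `β_0 = 0`.
  have hlow : ∀ k : ℕ, M.γ * M.ζ * ∑ t ∈ Finset.range (k + 1), betaSeq t * M.pairing s (x t) (V t) -
      k * (a * (q / μ)) ≤
        M.objective w betaSeq (lamSeq M.γ M.ζ wbar μ) V k s (x (k + 1)) := by
    intro k
    induction k with
    | zero =>
      have := mul_nonneg (hlam0 0).le (hw.nonneg s _ (M.D_subset s (hx 0)))
      simpa [objective_eq, betaSeq_zero, hlam] using this
    | succ k ih =>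
      have hstrong := hw.le_of_isMinOn (hx k) (hx (k + 1)) (hlam0 k)
        (L := fun D => M.γ * M.ζ * ∑ t ∈ Finset.range (k + 1), betaSeq t * M.pairing s D (V t))
        (fun τ => by
          simp only [pairing_add_smul, pairing_sub, mul_add, Finset.sum_add_distrib]
          rw [← mul_sub, ← Finset.sum_sub_distrib, mul_left_comm τ, Finset.mul_sum _ _ τ]
          congr 2
          exact Finset.sum_congr rfl fun t _ => by ring)
        (by
          have := hmin k
          rwa [← hlam])
      simp only [objective_eq, hlam] at ih
      rw [objective_eq, hlam, Finset.sum_range_succ _ (k + 1), Finset.sum_range_succ _ (k + 1)]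
      have hpair := (abs_le.1 (M.abs_pairing_sub_le s (x (k + 2)) (x (k + 1))
        (v := V (k + 1)) (by positivity) (hV (k + 1)))).1
      rw [pairing_sub] at hpair
      have hsymm : M.sqDist s (x (k + 2)) (x (k + 1)) = M.sqDist s (x (k + 1)) (x (k + 2)) := by
        simp only [sqDist, abs_sub_comm]
      rw [hsymm] at hpair
      set N := √(M.sqDist s (x (k + 1)) (x (k + 2))) with hN
      have hNN : M.sqDist s (x (k + 1)) (x (k + 2)) = N ^ 2 :=
        (Real.sq_sqrt (sqDist_nonneg _ _ _)).symm
      rw [hNN] at hstrong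
      have hpair' := mul_le_mul_of_nonneg_left hpair
        (mul_nonneg h0.le (betaSeq_nonneg (k + 1)))
      have hb : betaSeq (k + 1) ^ 2 = k + 1 := by rw [betaSeq_sq]; push_cast; ring
      have hC : M.γ * M.ζ * betaSeq (k + 1) * -(1 / (1 - M.γ) * N) =
          -(a * (betaSeq (k + 1) * N)) := by
        rw [ha]; field_simp
      rw [hC] at hpair'
      -- Moving from one minimizer to the next changes the new loss by at most `a β N`, while strong
      -- minimality gains a multiple of `N²`. Since `β² = k + 1` matches the growth of `λ`,
      -- completing the square costs exactly `a q / μ`.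
      have hsq : 0 ≤ (k + 1) * (a / (2 * q)) * (μ / 2 * N ^ 2) - a * (betaSeq (k + 1) * N) +
          a * (q / μ) := by
        have : (k + 1) * (a / (2 * q)) * (μ / 2 * N ^ 2) - a * (betaSeq (k + 1) * N) +
          a * (q / μ) = a * μ / (4 * q) * (betaSeq (k + 1) * N - 2 * q / μ) ^ 2 := by
          rw [← hb]
          field_simp
          ring
        rw [this]
        positivity
      -- The increase of `λ` only helps, as `w` is nonnegative.
      have hwn := mul_nonneg (by positivity : 0 ≤ a / (2 * q))
        (hw.nonneg s _ (M.D_subset s (hx (k + 1))))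
      push_cast
      simp only [mul_add, add_mul, one_mul] at *
      linarith
  have hup := isMinOn_iff.1 (hmin k) y hy
  have hlowk := hlow k
  rw [objective_eq, objective_eq, hlam] at hup
  rw [objective_eq, hlam] at hlowk
  have hwy := mul_le_mul_of_nonneg_left (hw.le_wbar s y (M.D_subset s hy)) (hlam0 k).le
  -- The factor `√(μ wbar)` in `λ` puts the regularization cost of the comparator on the same scale
  -- as the cost per round.
  have hfin : ((k : ℝ) + 1) * (a / (2 * q)) * wbar = (k + 1) / 2 * (a * (q / μ)) := by
    have : wbar = q ^ 2 / μ := by rw [hqq]; field_simp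
    rw [this]
    field_simp
  simp only [pairing_sub, mul_sub, Finset.sum_sub_distrib]
  rw [hfin] at hwy
  linarith

end Problem

namespace Problem

variable {S A : Type*} [Fintype S] [Fintype A] {M : Problem S A}

theorem pairing_eq_sum (s : S) (D : A → S → ℝ) (v : S → ℝ) :
    M.pairing s D v = ∑ s', (∑ a, M.ϑ s a * D a s') * v s' := by
  simp only [pairing]
  rw [Finset.sum_comm]
  refine Finset.sum_congr rfl fun s' _ => ?_
  rw [Finset.sum_mul]
  exact Finset.sum_congr rfl fun a _ => by ring

theorem abs_pairing_sub_le_two_mul (s : S) {x y : A → S → ℝ} (hx : x ∈ simplexFamily S A)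
    (hy : y ∈ simplexFamily S A) {v : S → ℝ} {C : ℝ} (hv : ∀ s, |v s| ≤ C) :
    |M.pairing s (x - y) v| ≤ 2 * C := by
  rw [pairing_sub, two_mul]
  exact (abs_sub _ _).trans (add_le_add (abs_pairing_le s hx hv) (abs_pairing_le s hy hv))

end Problem

/-! ### Concentration of the estimation errors -/

namespace Run

open Problem

variable {S A Ω : Type*} [Fintype S] [DecidableEq S] [Fintype A] [MeasurableSpace Ω]
  {Pr : Measure Ω} {M : Problem S A} {w : S → (A → S → ℝ) → ℝ} {β lam : ℕ → ℝ}
  {l : ℕ}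

theorem policy_mem (R : Run M w β lam l Pr) (t : ℕ) (ω : Ω) : R.π t ω ∈ M.policies := by
  cases t with
  | zero => exact R.init_mem ω
  | succ t => exact R.update_mem t ω

theorem estimate_eq (R : Run M w β lam l Pr) (t : ℕ) (ω : Ω) :
    R.estimate t ω = M.seEstimate l (R.π t ω) (R.nextState t ω) := rfl

theorem abs_estimate_le (R : Run M w β lam l Pr) (t : ℕ) (ω : Ω) (s : S) :
    |R.estimate t ω s| ≤ 1 / (1 - M.γ) := by
  have h := seEstimate_mem (R.policy_mem t ω) l (R.nextState t ω) s
  rw [estimate_eq, abs_of_nonpos h.2]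
  linarith [h.1]

theorem measurable_samples [IsProbabilityMeasure Pr] [MeasurableSpace (Fin l → S → A × S)]
    (R : Run M w β lam l Pr) (t : ℕ) : Measurable fun ω (i : Fin l) (s : S) => R.ξ t i s ω := by
  obtain ⟨ω₀⟩ := nonempty_of_isProbabilityMeasure Pr
  have : Nonempty (Fin l → S → A × S) := ⟨fun i s => R.ξ t i s ω₀⟩
  refine measurable_of_isDetermined (R := R) (I := {t} ×ˢ Finset.range l ×ˢ Finset.univ)
    fun ω ω' h => ?_
  ext1 i; ext1 s
  exact h (t, i, s) (by simp)

theorem indepFun_samples [IsProbabilityMeasure Pr] [MeasurableSpace (Fin l → S → A × S)]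
    (R : Run M w β lam l Pr) (n : ℕ) :
    IndepFun (fun ω (r : Fin n) (i : Fin l) (s : S) => R.ξ r i s ω)
      (fun ω (i : Fin l) (s : S) => R.ξ n i s ω) Pr := by
  obtain ⟨ω₀⟩ := nonempty_of_isProbabilityMeasure Pr
  have : Nonempty (Fin l → S → A × S) := ⟨fun i s => R.ξ n i s ω₀⟩
  refine indepFun_of_isDetermined (R := R) (I := Finset.range n ×ˢ Finset.range l ×ˢ Finset.univ)
    (J := {n} ×ˢ Finset.range l ×ˢ Finset.univ) ?_ (fun ω ω' h => ?_) fun ω ω' h => ?_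
  · rw [Finset.disjoint_left]
    rintro ⟨a, b, c⟩ h h'
    simp only [Finset.mem_product, Finset.mem_singleton, Finset.mem_range, Finset.mem_univ] at h h'
    omega
  · ext1 r; ext1 i; ext1 s
    exact h (r, i, s) (by simp)
  · ext1 i; ext1 s
    exact h (n, i, s) (by simp)

/-- Concentration of the weighted estimation errors, tested against functionals that depend on the
current policy. -/
theorem measureReal_weighted_error_ge_le [IsProbabilityMeasure Pr] (R : Run M w β lam l Pr)
    (κ : (S → A → S → ℝ) → S → ℝ) {b : ℝ} (hb : 0 < b)
    (hκ : ∀ π ∈ M.policies, ∀ v : S → ℝ, (∀ s, |v s| ≤ 1 / (1 - M.γ)) →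
      |∑ s, κ π s * v s| ≤ b) {k : ℕ} (hk : 1 ≤ k) {δ : ℝ} (hδ0 : 0 < δ) (hδ1 : δ ≤ 1) :
    Pr.real {ω | 3 * b / √(k : ℝ) * √(Real.log (1 / δ)) ≤ ∑ t ∈ Finset.Icc 1 k, weight k t *
      ∑ s, κ (R.π t ω) s * (R.estimate t ω s - M.truncatedValue l (R.π t ω) s)} ≤ δ := by
  let _ : MeasurableSpace (A × S) := ⊤
  have : DiscreteMeasurableSpace (A × S) := ⟨fun _ => trivial⟩
  -- The first `l` batches form a variable with finitely many values, as Azuma–Hoeffding requires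
  -- here. The default state beyond them is immaterial, since the estimate does not read it.
  let ext : (Fin l → S → A × S) → ℕ → S → S := fun e i s => if h : i < l then (e ⟨i, h⟩ s).2 else s
  have hext : ∀ t ω (π : S → A → S → ℝ), M.seEstimate l π (ext fun i s => R.ξ t i s ω) =
      M.seEstimate l π (R.nextState t ω) := fun t ω π =>
    seEstimate_congr fun j hj => by simp only [ext, hj, dif_pos]; rfl
  have h := measureReal_weighted_sum_ge_le (P := Pr) (R.measurable_samples) (R.indepFun_samples)
    (X := fun t ω e => ∑ s, κ (R.π t ω) s *
      (M.seEstimate l (R.π t ω) (ext e) s - M.truncatedValue l (R.π t ω) s))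
    (fun n ω ω' h => by
      have hπ : R.π n ω = R.π n ω' := R.adapted n ω ω' fun r hr i hi s =>
        congrFun (congrFun (h r hr) ⟨i, hi⟩) s
      simp only [hπ])
    hb (fun n ω e => hκ _ (R.policy_mem n ω) _ fun s => by
      have h1 := seEstimate_mem (R.policy_mem n ω) l (ext e) s
      have h2 := truncatedValue_mem (R.policy_mem n ω) l s
      rw [abs_le]
      constructor <;> linarith [h1.1, h1.2, h2.1, h2.2])
    (fun n ω => by
      simp only [hext]
      -- The policy is frozen at `ω` while the fresh samples at `ω'` are integrated, so unbiasedness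
      -- for a fixed policy applies.
      have hd : ∀ s, R.IsDetermined ({n} ×ˢ Finset.range l ×ˢ Finset.univ)
          fun ω' => M.seEstimate l (R.π n ω) (R.nextState n ω') s := fun s ω₁ ω₂ h => by
        refine congrFun (seEstimate_congr fun j hj => funext fun s => ?_) s
        simp only [nextState, h (n, j, s) (by simp [hj])]
      have hi := fun s => integrable_of_isDetermined (hd s)
      have hint : ∀ s, Integrable (fun ω' => κ (R.π n ω) s *
          (M.seEstimate l (R.π n ω) (R.nextState n ω') s - M.truncatedValue l (R.π n ω) s)) Pr :=
        fun s => ((hi s).sub (integrable_const _)).const_mul _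
      rw [integral_finsetSum _ fun s _ => hint s]
      refine Finset.sum_eq_zero fun s _ => ?_
      rw [integral_const_mul, integral_sub (hi s) (integrable_const _), integral_seEstimate]
      simp)
    hk hδ0 hδ1
  simp only [hext] at h
  exact h

end Run

/-- Subadditivity alone is used, so neither set has to be measurable. -/
theorem one_sub_le_measureReal {Ω : Type*} [MeasurableSpace Ω] {Pr : Measure Ω}
    [IsProbabilityMeasure Pr] {bad good : Set Ω} {δ : ℝ} (hbad : Pr.real bad ≤ δ)
    (h : ∀ ω, ω ∉ bad → ω ∈ good) : 1 - δ ≤ Pr.real good := by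
  have hsub : Set.univ ⊆ good ∪ bad := fun ω _ => (em (ω ∈ bad)).symm.imp_left (h ω)
  have h1 := (measureReal_mono (μ := Pr) hsub).trans (measureReal_union_le _ _)
  rw [probReal_univ] at h1
  linarith

/-! ### From regret and concentration to the error bound -/

namespace Problem

variable {S A : Type*} [Fintype S] [DecidableEq S] [Fintype A] (M : Problem S A)

/-- The vector that represents the functional `v ↦ -∑ᵤ d(s,u) ∑ₐ ϑ(a|u) ⟨π(u)ₐ - π'(u)ₐ, v⟩`, where
`d` is the occupancy measure of the policy `π'`. -/
noncomputable def advantage (π' : S → A → S → ℝ) (s : S) (π : S → A → S → ℝ) (s' : S) : ℝ :=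
  -∑ u, occupancy M.γ (M.natureChain π') s u * ∑ a, M.ϑ u a * (π u - π' u) a s'

theorem sum_advantage_mul (π' : S → A → S → ℝ) (s : S) (π : S → A → S → ℝ) (v : S → ℝ) :
    ∑ s', M.advantage π' s π s' * v s' =
      -∑ u, occupancy M.γ (M.natureChain π') s u * M.pairing u (π u - π' u) v := by
  simp only [advantage, pairing_eq_sum, neg_mul, Finset.sum_neg_distrib, Finset.sum_mul]
  rw [Finset.sum_comm]
  simp only [mul_assoc, Finset.mul_sum, Finset.sum_mul]

variable {M}

theorem abs_sum_occupancy_mul_le {π : S → A → S → ℝ} (hπ : π ∈ M.policies) (s : S) {g : S → ℝ}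
    {C : ℝ} (hg : ∀ s, |g s| ≤ C) :
    |∑ u, occupancy M.γ (M.natureChain π) s u * g u| ≤ C / (1 - M.γ) := by
  have hP := M.natureChain_mem_rowStochastic hπ
  calc _ ≤ ∑ u, occupancy M.γ (M.natureChain π) s u * C := by
        refine (Finset.abs_sum_le_sum_abs _ _).trans (Finset.sum_le_sum fun u _ => ?_)
        have h0 := occupancy_nonneg M.γ_nonneg hP s u
        rw [abs_mul, abs_of_nonneg h0]
        exact mul_le_mul_of_nonneg_left (hg u) h0
    _ = C / (1 - M.γ) := by
        rw [← Finset.sum_mul, sum_occupancy M.γ_nonneg M.γ_lt_one hP]; ring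

theorem sum_occupancy_mul_le {π : S → A → S → ℝ} (hπ : π ∈ M.policies) (s : S) {g : S → ℝ}
    {C : ℝ} (hg : ∀ s, g s ≤ C) :
    ∑ u, occupancy M.γ (M.natureChain π) s u * g u ≤ C / (1 - M.γ) := by
  have hP := M.natureChain_mem_rowStochastic hπ
  calc _ ≤ ∑ u, occupancy M.γ (M.natureChain π) s u * C :=
        Finset.sum_le_sum fun u _ =>
          mul_le_mul_of_nonneg_left (hg u) (occupancy_nonneg M.γ_nonneg hP s u)
    _ = C / (1 - M.γ) := by
        rw [← Finset.sum_mul, sum_occupancy M.γ_nonneg M.γ_lt_one hP]; ring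

end Problem

namespace Run

open Problem

variable {S A Ω : Type*} [Fintype S] [DecidableEq S] [Fintype A] [MeasurableSpace Ω]
  {Pr : Measure Ω} {M : Problem S A} {w : S → (A → S → ℝ) → ℝ} {wbar μ : ℝ} {l : ℕ}

theorem output_eq {lam : ℕ → ℝ} (R : Run M w betaSeq lam l Pr) (k : ℕ) (ω : Ω) (s : S) :
    R.output k ω s = ∑ t ∈ Finset.Icc 1 k, weight k t * R.estimate t ω s := rfl

/-- The output, split into the weighted estimation error, the bias, and the weighted
suboptimality. -/
theorem output_sub_eq {lam : ℕ → ℝ} (R : Run M w betaSeq lam l Pr) {k : ℕ} (hk : 1 ≤ k) (ω : Ω)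
    (s : S) (x : ℝ) : R.output k ω s - x =
      (∑ t ∈ Finset.Icc 1 k, weight k t * (R.estimate t ω s - M.truncatedValue l (R.π t ω) s)) +
      (∑ t ∈ Finset.Icc 1 k, weight k t *
        (M.truncatedValue l (R.π t ω) s - M.natureValue (R.π t ω) s)) +
      ∑ t ∈ Finset.Icc 1 k, weight k t * (M.natureValue (R.π t ω) s - x) := by
  have hx : x = ∑ t ∈ Finset.Icc 1 k, weight k t * x := by
    rw [← Finset.sum_mul, sum_weight hk, one_mul]
  conv_lhs => rw [hx]
  rw [output_eq, ← Finset.sum_sub_distrib, ← Finset.sum_add_distrib, ← Finset.sum_add_distrib]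
  exact Finset.sum_congr rfl fun t _ => by ring

theorem sum_weight_mul_le {k : ℕ} (hk : 1 ≤ k) {f : ℕ → ℝ} {C : ℝ} (hf : ∀ t, f t ≤ C) :
    ∑ t ∈ Finset.Icc 1 k, weight k t * f t ≤ C := by
  calc _ ≤ ∑ t ∈ Finset.Icc 1 k, weight k t * C :=
        Finset.sum_le_sum fun t _ => mul_le_mul_of_nonneg_left (hf t) (weight_nonneg k t)
    _ = C := by rw [← Finset.sum_mul, sum_weight hk, one_mul]

/-- The regret bound has factor `k + (k + 1) / 2 ≤ 8k / 3`, and the weights are normalized by a sum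
of at least `(2 / 3) k^{3/2}`; this produces `4 / √k`. -/
theorem weighted_regret_le (R : Run M w betaSeq (lamSeq M.γ M.ζ wbar μ) l Pr)
    (hwbar : 0 < wbar) (hμ : 0 < μ) (hw : M.IsDGF w wbar μ) {k : ℕ} (hk : 1 ≤ k) (ω : Ω)
    {π' : S → A → S → ℝ} (hπ' : π' ∈ M.policies) (u : S) :
    M.γ * M.ζ * ∑ t ∈ Finset.Icc 1 k, weight k t *
      M.pairing u (R.π t ω u - π' u) (R.estimate t ω) ≤
      4 * M.γ * M.ζ * √wbar / ((1 - M.γ) * √(μ * k)) := by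
  have hk' : (1 : ℝ) ≤ k := by exact_mod_cast hk
  have hγ := M.one_sub_γ_pos
  have h := hw.regret_le hwbar hμ (s := u) (V := fun t => R.estimate t ω) (R.abs_estimate_le · ω)
    (x := fun t => R.π t ω u) (fun k => R.update_mem k ω u) (fun k => R.update_min k ω u)
    (hπ' u) k
  rw [sum_range_succ_eq_sum_Icc (by simp [betaSeq_zero])] at h
  have hB := sum_betaSeq_pos hk
  simp only [weight, div_mul_eq_mul_div, ← Finset.sum_div]
  rw [mul_div_assoc', div_le_iff₀ hB]
  refine h.trans ?_
  have hsk : 0 < √(k : ℝ) := Real.sqrt_pos.2 (by linarith)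
  have hsμ : 0 < √μ := Real.sqrt_pos.2 hμ
  have hq : √(μ * wbar) / μ = √wbar / √μ := by
    rw [Real.sqrt_mul hμ.le]
    nth_rw 2 [← Real.mul_self_sqrt hμ.le]
    field_simp
  have ha : 0 ≤ M.γ * M.ζ / (1 - M.γ) * (√wbar / √μ) := by
    have := mul_nonneg M.γ_nonneg M.ζ_mem.1
    positivity
  rw [hq, Real.sqrt_mul hμ.le]
  calc (k + ((k : ℝ) + 1) / 2) * (M.γ * M.ζ / (1 - M.γ) * (√wbar / √μ))
      ≤ 4 / √(k : ℝ) * (2 / 3 * (k * √(k : ℝ))) * (M.γ * M.ζ / (1 - M.γ) * (√wbar / √μ)) := by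
        refine mul_le_mul_of_nonneg_right ?_ ha
        have : 4 / √(k : ℝ) * (2 / 3 * (k * √(k : ℝ))) = 8 / 3 * k := by field_simp; norm_num
        rw [this]
        linarith
    _ ≤ 4 / √(k : ℝ) * (∑ t ∈ Finset.Icc 1 k, betaSeq t) *
          (M.γ * M.ζ / (1 - M.γ) * (√wbar / √μ)) := by
        refine mul_le_mul_of_nonneg_right (mul_le_mul_of_nonneg_left (le_sum_betaSeq k) ?_) ha
        positivity
    _ = _ := by field_simp

/-- The deterministic part of the upper bound on the weighted suboptimality. -/
theorem weighted_suboptimality_le (R : Run M w betaSeq (lamSeq M.γ M.ζ wbar μ) l Pr)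
    (hwbar : 0 < wbar) (hμ : 0 < μ) (hw : M.IsDGF w wbar μ) {k : ℕ} (hk : 1 ≤ k) (ω : Ω)
    {π' : S → A → S → ℝ} (hπ' : π' ∈ M.policies) (s : S) :
    ∑ t ∈ Finset.Icc 1 k, weight k t * (M.natureValue (R.π t ω) s - M.natureValue π' s) ≤
      4 * M.γ * M.ζ * √wbar / ((1 - M.γ) ^ 2 * √(μ * k)) +
      M.γ * M.ζ * (2 * M.γ ^ l / (1 - M.γ) ^ 2 + ∑ t ∈ Finset.Icc 1 k, weight k t *
        ∑ s', M.advantage π' s (R.π t ω) s' *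
          (R.estimate t ω s' - M.truncatedValue l (R.π t ω) s')) := by
  have hγ := M.one_sub_γ_pos
  have hγζ : 0 ≤ M.γ * M.ζ := mul_nonneg M.γ_nonneg M.ζ_mem.1
  set d := fun u => occupancy M.γ (M.natureChain π') s u with hd
  have hsplit : ∀ t u, M.pairing u (R.π t ω u - π' u) (M.natureValue (R.π t ω)) =
      M.pairing u (R.π t ω u - π' u) (R.estimate t ω) -
      M.pairing u (R.π t ω u - π' u)
        (fun s' => M.truncatedValue l (R.π t ω) s' - M.natureValue (R.π t ω) s') -
      M.pairing u (R.π t ω u - π' u)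
        (fun s' => R.estimate t ω s' - M.truncatedValue l (R.π t ω) s') := by
    intro t u
    simp only [pairing_eq_sum, ← Finset.sum_sub_distrib]
    exact Finset.sum_congr rfl fun s' _ => by ring
  have hmain : ∑ t ∈ Finset.Icc 1 k, weight k t *
        (M.natureValue (R.π t ω) s - M.natureValue π' s) =
      (∑ u, d u * (M.γ * M.ζ * ∑ t ∈ Finset.Icc 1 k, weight k t *
        M.pairing u (R.π t ω u - π' u) (R.estimate t ω))) +
      M.γ * M.ζ * ((∑ t ∈ Finset.Icc 1 k, weight k t * -∑ u, d u *
        M.pairing u (R.π t ω u - π' u)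
        (fun s' => M.truncatedValue l (R.π t ω) s' - M.natureValue (R.π t ω) s')) +
      ∑ t ∈ Finset.Icc 1 k, weight k t * ∑ s', M.advantage π' s (R.π t ω) s' *
          (R.estimate t ω s' - M.truncatedValue l (R.π t ω) s')) := by
    -- The sums can be exchanged because the occupancy measure belongs to the comparator and is the
    -- same for all `t`.
    have hswap : ∑ u, d u * (M.γ * M.ζ * ∑ t ∈ Finset.Icc 1 k, weight k t *
        M.pairing u (R.π t ω u - π' u) (R.estimate t ω)) =
        M.γ * M.ζ * ∑ t ∈ Finset.Icc 1 k, weight k t * ∑ u, d u *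
          M.pairing u (R.π t ω u - π' u) (R.estimate t ω) := by
      simp only [Finset.mul_sum]
      rw [Finset.sum_comm]
      exact Finset.sum_congr rfl fun t _ => Finset.sum_congr rfl fun u _ => by ring
    rw [hswap, ← mul_add, ← Finset.sum_add_distrib, ← Finset.sum_add_distrib, Finset.mul_sum]
    refine Finset.sum_congr rfl fun t _ => ?_
    rw [natureValue_sub_natureValue hπ' (R.policy_mem t ω), sum_advantage_mul, ← mul_add, ← mul_add,
      mul_left_comm (M.γ * M.ζ)]
    congr 1
    rw [← add_assoc, ← sub_eq_add_neg, ← sub_eq_add_neg, ← Finset.sum_sub_distrib, ← Finset.sum_sub_distrib,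
      Finset.mul_sum]
    refine Finset.sum_congr rfl fun u _ => ?_
    rw [hsplit]
    ring
  rw [hmain]
  refine add_le_add ?_ (mul_le_mul_of_nonneg_left (add_le_add ?_ le_rfl) hγζ)
  · refine (sum_occupancy_mul_le hπ' s fun u =>
      R.weighted_regret_le hwbar hμ hw hk ω hπ' u).trans (le_of_eq ?_)
    rw [div_div]
    congr 1
    ring
  · refine sum_weight_mul_le hk fun t => ?_
    have h := abs_sum_occupancy_mul_le hπ' s fun u => M.abs_pairing_sub_le_two_mul u
      (mem_simplexFamily_of_mem_policies (R.policy_mem t ω) u)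
      (mem_simplexFamily_of_mem_policies hπ' u)
      (v := fun s' => M.truncatedValue l (R.π t ω) s' - M.natureValue (R.π t ω) s') fun s' => by
        have := truncatedValue_sub_natureValue_mem (R.policy_mem t ω) l s'
        rw [abs_of_nonneg this.1]
        exact this.2
    refine (neg_le_abs _).trans (h.trans (le_of_eq ?_))
    field_simp

/-- The error bounds hold with high probability. -/
theorem one_sub_le_measureReal_error [IsProbabilityMeasure Pr] (hwbar : 0 < wbar) (hμ : 0 < μ)
    (hw : M.IsDGF w wbar μ) {k : ℕ} (hk : 1 ≤ k) {δ : ℝ} (hδ0 : 0 < δ) (hδ1 : δ < 1)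
    (R : Run M w betaSeq (lamSeq M.γ M.ζ wbar μ) l Pr) :
    1 - δ ≤ Pr.real {ω | ∀ s,
      -(4 / ((1 - M.γ) * √(k : ℝ)) * √(Real.log (4 * Fintype.card S / δ)))
        ≤ R.output k ω s - M.natureOptValue s ∧
      R.output k ω s - M.natureOptValue s
        ≤ 4 * M.γ * M.ζ * √wbar / ((1 - M.γ) ^ 2 * √(μ * k)) +
          M.γ * M.ζ / (1 - M.γ) *
            (2 * M.γ ^ l / (1 - M.γ) +
              8 / ((1 - M.γ) * √(k : ℝ)) * √(Real.log (2 * Fintype.card S / δ))) +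
          M.γ ^ l / (1 - M.γ) +
          4 / ((1 - M.γ) * √(k : ℝ)) * √(Real.log (4 * Fintype.card S / δ))} := by
  rcases isEmpty_or_nonempty S with hS | hS
  · simp [hδ0.le]
  have hγ := M.one_sub_γ_pos
  have hγζ : 0 ≤ M.γ * M.ζ := mul_nonneg M.γ_nonneg M.ζ_mem.1
  have hk' : (1 : ℝ) ≤ k := by exact_mod_cast hk
  have hsk : 0 < √(k : ℝ) := Real.sqrt_pos.2 (by linarith)
  have hn : (1 : ℝ) ≤ Fintype.card S := by exact_mod_cast Fintype.card_pos
  set n : ℝ := (Fintype.card S : ℝ) with hndef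
  have hδ2 : 0 < δ / (2 * n) := by positivity
  have hδ4 : 0 < δ / (4 * n) := by positivity
  have hδ2' : δ / (2 * n) ≤ 1 := by rw [div_le_one (by positivity)]; linarith
  have hδ4' : δ / (4 * n) ≤ 1 := by rw [div_le_one (by positivity)]; linarith
  have hη : 0 < 1 / ((1 - M.γ) * √(k : ℝ)) := by positivity
  -- One comparator is fixed for each state, with slack equal to one unit `c = 1 / ((1 - γ) √k)` of
  -- the error bound.
  choose π' hπ' hlt using fun s => exists_natureValue_lt (M := M) hη s
  have hE1 := fun s => R.measureReal_weighted_error_ge_le (fun _ => Pi.single s 1)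
    (b := 1 / (1 - M.γ)) (by positivity)
    (fun π _ v hv => by simpa [Pi.single_apply] using hv s) hk hδ4 hδ4'
  have hE2 := fun s => R.measureReal_weighted_error_ge_le (fun _ => -Pi.single s 1)
    (b := 1 / (1 - M.γ)) (by positivity)
    (fun π _ v hv => by simpa [Pi.single_apply] using hv s) hk hδ4 hδ4'
  have hE3 := fun s => R.measureReal_weighted_error_ge_le (M.advantage (π' s) s)
    (b := 2 * (1 / (1 - M.γ)) / (1 - M.γ)) (by positivity)
    (fun π hπ v hv => by
      rw [sum_advantage_mul, abs_neg]
      exact abs_sum_occupancy_mul_le (hπ' s) s fun u => M.abs_pairing_sub_le_two_mul u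
        (mem_simplexFamily_of_mem_policies hπ u)
        (mem_simplexFamily_of_mem_policies (hπ' s) u) hv) hk hδ2 hδ2'
  rw [one_div_div] at hE1 hE2 hE3
  set L4 := √(Real.log (4 * n / δ)) with hL4
  set L2 := √(Real.log (2 * n / δ)) with hL2
  -- Since `4n / δ ≥ 4 > e`, the slack `c` is at most `c L4`; it raises the concentration constant
  -- from 3 to 4.
  have hL4' : 1 ≤ L4 := by
    rw [hL4, Real.one_le_sqrt, Real.le_log_iff_exp_le (by positivity), le_div_iff₀ hδ0]
    nlinarith [Real.exp_one_lt_d9, Real.exp_pos 1]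
  set c := 1 / ((1 - M.γ) * √(k : ℝ)) with hc
  set err : S → Ω → ℝ := fun s ω => ∑ t ∈ Finset.Icc 1 k, weight k t *
    (R.estimate t ω s - M.truncatedValue l (R.π t ω) s) with herr
  set adv : S → Ω → ℝ := fun s ω => ∑ t ∈ Finset.Icc 1 k, weight k t *
    ∑ s', M.advantage (π' s) s (R.π t ω) s' *
      (R.estimate t ω s' - M.truncatedValue l (R.π t ω) s') with hadv
  have hc1 : 3 * (1 / (1 - M.γ)) / √(k : ℝ) = 3 * c := by rw [hc]; field_simp
  have hc3 : 3 * (2 * (1 / (1 - M.γ)) / (1 - M.γ)) / √(k : ℝ) = 6 * c / (1 - M.γ) := by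
    rw [hc]; field_simp; norm_num
  have hsingle : ∀ s (v : S → ℝ), ∑ s', (Pi.single s 1 : S → ℝ) s' * v s' = v s := fun s v => by
    simp [Pi.single_apply]
  have hB1 : ∀ s, Pr.real {ω | 3 * c * L4 ≤ err s ω} ≤ δ / (4 * n) := fun s => by
    have h := hE1 s
    simp only [hsingle s (fun s' => R.estimate _ _ s' - _), hc1] at h
    exact h
  have hB2 : ∀ s, Pr.real {ω | 3 * c * L4 ≤ -err s ω} ≤ δ / (4 * n) := fun s => by
    have h := hE2 s
    simp only [Pi.neg_apply, neg_mul, Finset.sum_neg_distrib, mul_neg,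
      hsingle s (fun s' => R.estimate _ _ s' - _), hc1] at h
    exact h
  have hB3 : ∀ s, Pr.real {ω | 6 * c / (1 - M.γ) * L2 ≤ adv s ω} ≤ δ / (2 * n) := fun s => by
    rw [← hc3]
    exact hE3 s
  have hbad : Pr.real (⋃ s, ({ω | 3 * c * L4 ≤ err s ω} ∪ {ω | 3 * c * L4 ≤ -err s ω} ∪
      {ω | 6 * c / (1 - M.γ) * L2 ≤ adv s ω})) ≤ δ := by
    refine (measureReal_iUnion_fintype_le _).trans ?_
    calc _ ≤ ∑ _s : S, δ / n := by
          refine Finset.sum_le_sum fun s _ => ?_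
          refine (measureReal_union_le _ _).trans
            ((add_le_add (measureReal_union_le _ _) le_rfl).trans ?_)
          -- The failure probability of each state is split among the two signs of its error and the
          -- test against its comparator.
          have : δ / n = δ / (4 * n) + δ / (4 * n) + δ / (2 * n) := by field_simp; norm_num
          rw [this]
          exact add_le_add (add_le_add (hB1 s) (hB2 s)) (hB3 s)
      _ = δ := by
          rw [Finset.sum_const, Finset.card_univ, nsmul_eq_mul, ← hndef]
          field_simp
  have key : ∀ ω, ω ∉ (⋃ s, ({ω | 3 * c * L4 ≤ err s ω} ∪ {ω | 3 * c * L4 ≤ -err s ω} ∪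
      {ω | 6 * c / (1 - M.γ) * L2 ≤ adv s ω})) → ∀ s,
      -(4 / ((1 - M.γ) * √(k : ℝ)) * L4) ≤ R.output k ω s - M.natureOptValue s ∧
      R.output k ω s - M.natureOptValue s
        ≤ 4 * M.γ * M.ζ * √wbar / ((1 - M.γ) ^ 2 * √(μ * k)) +
          M.γ * M.ζ / (1 - M.γ) * (2 * M.γ ^ l / (1 - M.γ) + 8 / ((1 - M.γ) * √(k : ℝ)) * L2) +
          M.γ ^ l / (1 - M.γ) + 4 / ((1 - M.γ) * √(k : ℝ)) * L4 := by
    intro ω hω s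
    simp only [Set.mem_iUnion, Set.mem_union, Set.mem_ofPred_eq, not_exists, not_or, not_le] at hω
    obtain ⟨⟨h1, h2⟩, h3⟩ := hω s
    have hbias0 : 0 ≤ ∑ t ∈ Finset.Icc 1 k, weight k t *
        (M.truncatedValue l (R.π t ω) s - M.natureValue (R.π t ω) s) :=
      Finset.sum_nonneg fun t _ => mul_nonneg (weight_nonneg k t)
        (truncatedValue_sub_natureValue_mem (R.policy_mem t ω) l s).1
    have hbias1 := sum_weight_mul_le hk (fun t =>
      (truncatedValue_sub_natureValue_mem (R.policy_mem t ω) l s).2)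
    have hsub0 : 0 ≤ ∑ t ∈ Finset.Icc 1 k, weight k t *
        (M.natureValue (R.π t ω) s - M.natureOptValue s) :=
      Finset.sum_nonneg fun t _ => mul_nonneg (weight_nonneg k t)
        (sub_nonneg.2 (natureOptValue_le (R.policy_mem t ω) s))
    have hsub1 := R.weighted_suboptimality_le hwbar hμ hw hk ω (hπ' s) s
    have ho := R.output_sub_eq hk ω s (M.natureOptValue s)
    have ho' := R.output_sub_eq hk ω s (M.natureValue (π' s) s)
    have hcL : 0 < c * L4 := mul_pos hη (by linarith)
    have hc4 : 4 / ((1 - M.γ) * √(k : ℝ)) = 4 * c := by rw [hc]; ring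
    have hc8 : 8 / ((1 - M.γ) * √(k : ℝ)) = 8 * c := by rw [hc]; ring
    have hcc : c ≤ c * L4 := le_mul_of_one_le_right hη.le hL4'
    rw [hc4, hc8]
    constructor
    · linarith
    · have hz : adv s ω ≤ 8 * c / (1 - M.γ) * L2 := by
        refine h3.le.trans (mul_le_mul_of_nonneg_right ?_ (Real.sqrt_nonneg _))
        exact div_le_div_of_nonneg_right (by linarith) hγ.le
      have hz' := mul_le_mul_of_nonneg_left hz hγζ
      have hfin : M.γ * M.ζ / (1 - M.γ) * (2 * M.γ ^ l / (1 - M.γ) + 8 * c * L2) =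
          M.γ * M.ζ * (2 * M.γ ^ l / (1 - M.γ) ^ 2) +
            M.γ * M.ζ * (8 * c / (1 - M.γ) * L2) := by
        field_simp
      rw [hfin]
      rw [mul_add] at hsub1
      have := hlt s
      linarith
  exact one_sub_le_measureReal hbad key

end Run

/-! ### Strong convexity against range -/

namespace Problem

variable {S A : Type*} [Fintype S] [Fintype A] {M : Problem S A} {w : S → (A → S → ℝ) → ℝ}
  {wbar μ : ℝ}

/-- If there are two states, then the modulus of strong convexity is bounded by the range of the
distance generating functions. -/
theorem IsDGF.le_four_mul [Nontrivial S] (hw : M.IsDGF w wbar μ) : μ ≤ 4 * wbar := by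
  classical
  obtain ⟨s₁, s₂, hne⟩ := exists_pair_ne S
  set e₁ : A → S → ℝ := fun _ => Pi.single s₁ 1 with he₁
  set e₂ : A → S → ℝ := fun _ => Pi.single s₂ 1 with he₂
  have h₁ : e₁ ∈ simplexFamily S A := fun _ => single_mem_stdSimplex ℝ s₁
  have h₂ : e₂ ∈ simplexFamily S A := fun _ => single_mem_stdSimplex ℝ s₂
  have hconv := hw.convexOn s₁
  -- At the midpoint of two vertices the Bregman bound gives `μ / 2 ≤ w e₁ + w e₂ - 2 w x ≤ 2 wbar`.
  set x : A → S → ℝ := (1 / 2 : ℝ) • e₁ + (1 / 2 : ℝ) • e₂ with hx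
  have hxm : x ∈ simplexFamily S A :=
    hconv.1 h₁ h₂ (by norm_num) (by norm_num) (by norm_num)
  have hdist : M.sqDist s₁ x e₁ = 1 := by
    have hrow : ∀ a, ∑ s', |x a s' - e₁ a s'| = 1 := by
      intro a
      have : ∀ s', |x a s' - e₁ a s'| = 1 / 2 * e₁ a s' + 1 / 2 * e₂ a s' := by
        intro s'
        simp only [hx, he₁, he₂, Pi.add_apply, Pi.smul_apply, smul_eq_mul, Pi.single_apply]
        by_cases h : s' = s₁
        · have h' : s' ≠ s₂ := fun h'' => hne (h.symm.trans h'')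
          simp only [h, hne, if_true, if_false]
          norm_num [abs_of_nonpos]
        · by_cases h' : s' = s₂
          · simp only [h', hne.symm, if_true, if_false]
            norm_num
          · simp [h, h']
      simp only [this, Finset.sum_add_distrib, ← Finset.mul_sum, (h₁ a).2, (h₂ a).2]
      norm_num
    simp only [sqDist, hrow, one_pow, mul_one, (M.ϑ_mem s₁).2]
  have h := hw.sqDist_le (s := s₁) hxm h₁ (m := w s₁ x - w s₁ e₂) fun τ hτ => by
    have hτ1 : 0 < 1 + τ := by linarith [hτ.1]
    have hz : x + τ • (e₁ - x) ∈ simplexFamily S A := by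
      have := hconv.1.lineMap_mem hxm h₁ (Set.Ioo_subset_Icc_self hτ)
      simpa [AffineMap.lineMap_apply, add_comm] using this
    -- The midpoint lies between the point at parameter `τ` towards `e₁` and the vertex `e₂`.
    -- Convexity then bounds the slope towards `e₁` below by `w x - w e₂`.
    have hc := hconv.2 hz h₂ (by positivity : 0 ≤ 1 / (1 + τ))
      (div_nonneg hτ.1.le hτ1.le) (by field_simp)
    have hxe : (1 / (1 + τ)) • (x + τ • (e₁ - x)) + (τ / (1 + τ)) • e₂ = x := by
      ext a s'
      simp only [hx, Pi.add_apply, Pi.smul_apply, Pi.sub_apply, smul_eq_mul]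
      field_simp
      ring
    rw [hxe, smul_eq_mul, smul_eq_mul, div_mul_eq_mul_div, div_mul_eq_mul_div, ← add_div,
      le_div_iff₀ hτ1] at hc
    linarith
  rw [hdist] at h
  linarith [hw.le_wbar s₁ _ h₁, hw.le_wbar s₁ _ h₂, hw.nonneg s₁ _ hxm]

end Problem

/-! ### Choice of the number of iterations and of simulator steps -/

section Parameters

variable {n p : ℕ} {γ ζ wbar μ ε δ : ℝ}

theorem half_le_log_of_two_le {x : ℝ} (hx : 2 ≤ x) : 1 / 2 ≤ Real.log x := by
  linarith [Real.log_two_gt_d9, Real.log_le_log (by norm_num) hx]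

theorem lt_one_of_pow_le (hγ0 : 0 ≤ γ) (hp : ε ^ p ≤ (1 - γ) / 2) : ε < 1 := by
  by_contra h
  linarith [one_le_pow₀ (not_lt.1 h) (n := p)]

/-- Logarithms of the assumption on `ε`: additive constants and `log (1 / (1 - γ))` can be charged
to `log (1 / ε)` at a cost depending only on `p`. -/
theorem log_two_div_le (hγ1 : γ < 1) (hε : 0 < ε) (hp : ε ^ p ≤ (1 - γ) / 2) :
    Real.log 2 + Real.log (1 / (1 - γ)) ≤ p * Real.log (1 / ε) := by
  have ha : 0 < 1 - γ := by linarith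
  rw [← Real.log_mul (by norm_num) (by positivity), ← Real.log_pow]
  refine Real.log_le_log (by positivity) ?_
  rw [div_pow, one_pow, mul_one_div, div_le_div_iff₀ ha (by positivity)]
  linarith

/-- The number of steps of the simulator-based evaluation makes the bias small. -/
theorem pow_ceil_le (hγ0 : 0 ≤ γ) (hγ1 : γ < 1) (hε : 0 < ε) (hp : ε ^ p ≤ (1 - γ) / 2) :
    γ ^ ⌈(1 + 5 * p) * Real.log (1 / ε) / (1 - γ)⌉₊ ≤ (1 - γ) ^ 2 * ε / 8 := by
  have ha : 0 < 1 - γ := by linarith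
  set l := ⌈(1 + 5 * p) * Real.log (1 / ε) / (1 - γ)⌉₊ with hl
  have hl1 : (1 + 5 * p) * Real.log (1 / ε) ≤ l * (1 - γ) := by
    rw [← div_le_iff₀ ha]
    exact Nat.le_ceil _
  have hlog := log_two_div_le hγ1 hε hp
  have hloga : 0 ≤ Real.log (1 / (1 - γ)) :=
    Real.log_nonneg (by rw [le_div_iff₀ ha]; linarith)
  calc γ ^ l ≤ Real.exp (-(1 - γ)) ^ l :=
        pow_le_pow_left₀ hγ0 (by linarith [Real.add_one_le_exp (-(1 - γ))]) l
    _ = Real.exp (-(l * (1 - γ))) := by rw [← Real.exp_nat_mul]; congr 1; ring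
    -- The exponent must exceed `3 log 2 + 2 log (1 / (1 - γ)) + log (1 / ε)`; the summand `5p`
    -- covers the first two terms with room to spare.
    _ ≤ Real.exp (Real.log ((1 - γ) ^ 2 * ε / 8)) := by
        refine Real.exp_le_exp.2 ?_
        have h8 : Real.log 8 = 3 * Real.log 2 := by
          rw [show (8 : ℝ) = 2 ^ 3 by norm_num, Real.log_pow]; norm_num
        rw [Real.log_div (by positivity) (by norm_num), Real.log_mul (by positivity) hε.ne',
          Real.log_pow, h8]
        rw [one_div, Real.log_inv] at hlog hl1 hloga
        rw [one_div, Real.log_inv] at hlog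
        push_cast
        nlinarith [Real.log_two_gt_d9]
    _ = _ := Real.exp_log (by positivity)

/-- Rounding up adds at most 1, and `1 - γ ≤ 1 ≤ 2 log 2 ≤ 2p log (1 / ε)` turns `5p` into `7p`. -/
theorem ceil_le (hγ0 : 0 ≤ γ) (hγ1 : γ < 1) (hε : 0 < ε) (hp : ε ^ p ≤ (1 - γ) / 2) :
    (⌈(1 + 5 * p) * Real.log (1 / ε) / (1 - γ)⌉₊ : ℝ) ≤
      (1 + 7 * p) * Real.log (1 / ε) / (1 - γ) := by
  have ha : 0 < 1 - γ := by linarith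
  have hΛ : 0 ≤ Real.log (1 / ε) :=
    Real.log_nonneg (by rw [le_div_iff₀ hε]; linarith [lt_one_of_pow_le hγ0 hp])
  have hlog := log_two_div_le hγ1 hε hp
  have hloga : 0 ≤ Real.log (1 / (1 - γ)) :=
    Real.log_nonneg (by rw [le_div_iff₀ ha]; linarith)
  refine (Nat.ceil_lt_add_one (by positivity)).le.trans ?_
  rw [div_add_one ha.ne']
  refine div_le_div_of_nonneg_right ?_ ha.le
  linarith [half_le_log_of_two_le le_rfl]

/-- A term of the error bound of the form `X / √k`. -/
theorem div_sqrt_le {X k x b : ℝ} (hx : 0 < x) (hk : x ≤ k) (hb : 0 ≤ b)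
    (hX : X ^ 2 ≤ b ^ 2 * x) : X / √k ≤ b := by
  have hk0 : 0 < k := hx.trans_le hk
  rw [div_le_iff₀ (Real.sqrt_pos.2 hk0)]
  refine abs_le_of_sq_le_sq' ?_ (by positivity) |>.2
  rw [mul_pow, Real.sq_sqrt hk0.le]
  exact hX.trans (mul_le_mul_of_nonneg_left hk (sq_nonneg b))

/-- The number of iterations is `⌈8192 x⌉` with `x` the following quantity. -/
noncomputable def iterationScale (n : ℕ) (γ ζ wbar μ ε δ : ℝ) : ℝ :=
  (γ ^ 2 * ζ ^ 2 * wbar / ((1 - γ) ^ 4 * μ * ε ^ 2) + 1 / ((1 - γ) ^ 2 * ε ^ 2)) *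
    Real.log (n / δ)

/-- Keeps the scale away from zero, so that rounding and the extra iteration 0 cost only a constant
factor. -/
theorem half_le_iterationScale (hn : 2 ≤ n) (hγ0 : 0 ≤ γ) (hγ1 : γ < 1) (hwbar : 0 < wbar)
    (hμ : 0 < μ) (hε : 0 < ε) (hε1 : ε < 1) (hδ0 : 0 < δ) (hδ1 : δ < 1) :
    1 / 2 ≤ iterationScale n γ ζ wbar μ ε δ := by
  have ha : 0 < 1 - γ := by linarith
  have hn' : (2 : ℝ) ≤ n := by exact_mod_cast hn
  have hL : 1 / 2 ≤ Real.log (n / δ) :=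
    half_le_log_of_two_le (by rw [le_div_iff₀ hδ0]; linarith)
  have hv : 1 ≤ 1 / ((1 - γ) ^ 2 * ε ^ 2) := by
    rw [le_div_iff₀ (by positivity), one_mul]
    exact mul_le_one₀ (pow_le_one₀ ha.le (by linarith)) (by positivity) (pow_le_one₀ hε.le hε1.le)
  have hu : 0 ≤ γ ^ 2 * ζ ^ 2 * wbar / ((1 - γ) ^ 4 * μ * ε ^ 2) := by positivity
  simp only [iterationScale]
  nlinarith

theorem estimation_term_le {a x k L L' : ℝ} (ha : 0 < a) (hε : 0 < ε) (hL' : 0 ≤ L')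
    (hL : L' ≤ 3 * L) (hx : 0 < x) (hvx : 1 / (a ^ 2 * ε ^ 2) * L ≤ x) (hk : 8192 * x ≤ k) :
    4 / (a * √k) * √L' ≤ ε / 8 := by
  have := div_sqrt_le (X := 4 / a * √L') (by linarith) hk (by positivity : 0 ≤ ε / 8) (by
    rw [mul_pow, Real.sq_sqrt hL']
    calc (4 / a) ^ 2 * L' ≤ (4 / a) ^ 2 * (3 * L) := by gcongr
      _ = 48 * ε ^ 2 * (1 / (a ^ 2 * ε ^ 2) * L) := by field_simp; ring
      _ ≤ 48 * ε ^ 2 * x := by gcongr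
      _ ≤ 128 * ε ^ 2 * x := by gcongr; norm_num
      _ = _ := by ring)
  refine le_trans (le_of_eq ?_) this
  field_simp

theorem regret_term_le {a x k : ℝ} (ha : 0 < a) (hwbar : 0 < wbar) (hμ : 0 < μ) (hε : 0 < ε)
    (hx : 0 < x) (hux : γ ^ 2 * ζ ^ 2 * wbar / (a ^ 4 * μ * ε ^ 2) ≤ 2 * x) (hk : 8192 * x ≤ k) :
    4 * γ * ζ * √wbar / (a ^ 2 * √(μ * k)) ≤ ε / 4 := by
  have := div_sqrt_le (X := 4 * γ * ζ * √wbar / (a ^ 2 * √μ)) (by linarith) hk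
    (by positivity : 0 ≤ ε / 4) (by
      calc (4 * γ * ζ * √wbar / (a ^ 2 * √μ)) ^ 2
          = 16 * ε ^ 2 * (γ ^ 2 * ζ ^ 2 * wbar / (a ^ 4 * μ * ε ^ 2)) := by
            rw [div_pow, mul_pow, mul_pow (a ^ 2), Real.sq_sqrt hwbar.le, Real.sq_sqrt hμ.le]
            field_simp
            ring
        _ ≤ 16 * ε ^ 2 * (2 * x) := by gcongr
        _ = 32 * ε ^ 2 * x := by ring
        _ ≤ 512 * ε ^ 2 * x := by gcongr; norm_num
        _ = _ := by ring)
  rw [Real.sqrt_mul hμ.le]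
  refine le_trans (le_of_eq ?_) this
  rw [div_div]
  congr 1
  ring

/-- The term has no factor `wbar / μ`; inserting it costs `μ / wbar ≤ 4`. This is the term that
dictates the constant 8192, as `128 · 4 = 8192 / 16`. -/
theorem noise_term_le {a x k L L' : ℝ} (ha : 0 < a) (hwbar : 0 < wbar) (hμ : 0 < μ)
    (hμw : μ ≤ 4 * wbar) (hε : 0 < ε) (hL' : 0 ≤ L') (hL : L' ≤ 2 * L) (hx : 0 < x)
    (hux : γ ^ 2 * ζ ^ 2 * wbar / (a ^ 4 * μ * ε ^ 2) * L ≤ x) (hk : 8192 * x ≤ k) :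
    γ * ζ / a * (8 / (a * √k) * √L') ≤ ε / 4 := by
  have hL0 : 0 ≤ L := by linarith
  have := div_sqrt_le (X := γ * ζ / a * (8 / a) * √L') (by linarith) hk
    (by positivity : 0 ≤ ε / 4) (by
      rw [mul_pow, Real.sq_sqrt hL']
      have h2 : μ / wbar ≤ 4 := by rw [div_le_iff₀ hwbar]; exact hμw
      have h0 : 0 ≤ γ ^ 2 * ζ ^ 2 * wbar / (a ^ 4 * μ * ε ^ 2) := by positivity
      calc (γ * ζ / a * (8 / a)) ^ 2 * L' ≤ (γ * ζ / a * (8 / a)) ^ 2 * (2 * L) := by gcongr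
        _ = 128 * ε ^ 2 * (γ ^ 2 * ζ ^ 2 * wbar / (a ^ 4 * μ * ε ^ 2) * L) * (μ / wbar) := by
          field_simp; ring
        _ ≤ 128 * ε ^ 2 * (γ ^ 2 * ζ ^ 2 * wbar / (a ^ 4 * μ * ε ^ 2) * L) * 4 :=
          mul_le_mul_of_nonneg_left h2 (by positivity)
        _ ≤ 128 * ε ^ 2 * x * 4 := by gcongr
        _ = _ := by ring)
  refine le_trans (le_of_eq ?_) this
  field_simp

theorem bias_terms_le {a : ℝ} (ha : 0 < a) (ha1 : a ≤ 1) (hγ0 : 0 ≤ γ) (hγ1 : γ < 1)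
    (hζ0 : 0 ≤ ζ) (hζ1 : ζ ≤ 1) (hε : 0 < ε) {l : ℕ} (hl : γ ^ l ≤ a ^ 2 * ε / 8) :
    γ ^ l / a ≤ ε / 8 ∧ γ * ζ / a * (2 * γ ^ l / a) ≤ ε / 4 := by
  constructor
  · rw [div_le_iff₀ ha]
    refine hl.trans ?_
    have : a ^ 2 ≤ a := by nlinarith
    nlinarith
  · have h1 : γ * ζ / a * (2 * γ ^ l / a) = γ * ζ * (2 * γ ^ l / a ^ 2) := by field_simp
    have h2 : 2 * γ ^ l / a ^ 2 ≤ ε / 4 := by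
      rw [div_le_iff₀ (by positivity)]; linarith
    rw [h1]
    have h3 : γ * ζ ≤ 1 := mul_le_one₀ hγ1.le hζ0 hζ1
    calc _ ≤ 1 * (2 * γ ^ l / a ^ 2) := mul_le_mul_of_nonneg_right h3 (by positivity)
      _ ≤ _ := by rw [one_mul]; exact h2

/-- The budget in the upper bound is `ε / 4` each for the regret, the bias within it and the noise
within it, and `ε / 8` each for the truncation and the estimation error. -/
theorem error_le (hn : 2 ≤ n) (hγ0 : 0 ≤ γ) (hγ1 : γ < 1) (hζ0 : 0 ≤ ζ) (hζ1 : ζ ≤ 1)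
    (hwbar : 0 < wbar) (hμ : 0 < μ) (hμw : μ ≤ 4 * wbar) (hε : 0 < ε) (hε1 : ε < 1) (hδ0 : 0 < δ)
    (hδ1 : δ < 1) {k l : ℕ} (hk : 8192 * iterationScale n γ ζ wbar μ ε δ ≤ k)
    (hl : γ ^ l ≤ (1 - γ) ^ 2 * ε / 8) :
    4 / ((1 - γ) * √(k : ℝ)) * √(Real.log (4 * n / δ)) ≤ ε / 8 ∧
    4 * γ * ζ * √wbar / ((1 - γ) ^ 2 * √(μ * k)) +
      γ * ζ / (1 - γ) * (2 * γ ^ l / (1 - γ) +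
        8 / ((1 - γ) * √(k : ℝ)) * √(Real.log (2 * n / δ))) +
      γ ^ l / (1 - γ) + 4 / ((1 - γ) * √(k : ℝ)) * √(Real.log (4 * n / δ)) ≤ ε := by
  have ha : 0 < 1 - γ := by linarith
  have hx0 := half_le_iterationScale (ζ := ζ) hn hγ0 hγ1 hwbar hμ hε hε1 hδ0 hδ1
  have hn' : (2 : ℝ) ≤ n := by exact_mod_cast hn
  have hL : 1 / 2 ≤ Real.log (n / δ) :=
    half_le_log_of_two_le (by rw [le_div_iff₀ hδ0]; linarith)
  have hnδ : 0 < n / δ := by positivity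
  have hlog2 : Real.log 2 ≤ Real.log (n / δ) :=
    Real.log_le_log (by norm_num) (by rw [le_div_iff₀ hδ0]; linarith)
  have hL2 : Real.log (2 * n / δ) ≤ 2 * Real.log (n / δ) := by
    rw [mul_div_assoc, Real.log_mul (by norm_num) hnδ.ne']; linarith
  have hL4 : Real.log (4 * n / δ) ≤ 3 * Real.log (n / δ) := by
    rw [mul_div_assoc, Real.log_mul (by norm_num) hnδ.ne', show (4 : ℝ) = 2 ^ 2 by norm_num,
      Real.log_pow]
    push_cast; linarith
  have hL20 : 0 ≤ Real.log (2 * n / δ) :=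
    Real.log_nonneg (by rw [le_div_iff₀ hδ0]; linarith)
  have hL40 : 0 ≤ Real.log (4 * n / δ) :=
    Real.log_nonneg (by rw [le_div_iff₀ hδ0]; linarith)
  have hx : 0 < iterationScale n γ ζ wbar μ ε δ := by linarith
  have hu0 : 0 ≤ γ ^ 2 * ζ ^ 2 * wbar / ((1 - γ) ^ 4 * μ * ε ^ 2) := by positivity
  have hv0 : 0 ≤ 1 / ((1 - γ) ^ 2 * ε ^ 2) := by positivity
  have huL := mul_nonneg hu0 (by linarith : 0 ≤ Real.log (n / δ))
  have hvL := mul_nonneg hv0 (by linarith : 0 ≤ Real.log (n / δ))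
  have hux : γ ^ 2 * ζ ^ 2 * wbar / ((1 - γ) ^ 4 * μ * ε ^ 2) * Real.log (n / δ) ≤
      iterationScale n γ ζ wbar μ ε δ := by
    rw [iterationScale, add_mul]; linarith
  have hvx : 1 / ((1 - γ) ^ 2 * ε ^ 2) * Real.log (n / δ) ≤
      iterationScale n γ ζ wbar μ ε δ := by
    rw [iterationScale, add_mul]; linarith
  have hux' : γ ^ 2 * ζ ^ 2 * wbar / ((1 - γ) ^ 4 * μ * ε ^ 2) ≤
      2 * iterationScale n γ ζ wbar μ ε δ := by
    linarith [mul_le_mul_of_nonneg_left hL hu0]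
  have hT5 := estimation_term_le ha hε hL40 hL4 hx hvx hk
  have hT1 := regret_term_le ha hwbar hμ hε hx hux' hk
  have hT3 := noise_term_le ha hwbar hμ hμw hε hL20 hL2 hx hux hk
  obtain ⟨hT4, hT2⟩ := bias_terms_le ha (by linarith) hγ0 hγ1 hζ0 hζ1 hε hl
  refine ⟨hT5, ?_⟩
  rw [mul_add]
  linarith

/-- The choice of the parameters that proves the sample complexity. -/
theorem exists_parameters (p : ℕ) : ∃ K : ℝ, 0 < K ∧
    ∀ (n : ℕ) (γ ζ wbar μ ε δ : ℝ), 2 ≤ n → 0 ≤ γ → γ < 1 → 0 ≤ ζ → ζ ≤ 1 →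
      0 < wbar → 0 < μ → 0 < ε → ε ^ p ≤ (1 - γ) / 2 → 0 < δ → δ < 1 →
      ∃ k l : ℕ, 1 ≤ k ∧
        (totalSamples n l k : ℝ) ≤
          K * (γ ^ 2 * ζ ^ 2 * wbar * n * Real.log (1 / ε) / ((1 - γ) ^ 5 * μ * ε ^ 2) *
                Real.log (n / δ) +
              n * Real.log (1 / ε) / ((1 - γ) ^ 3 * ε ^ 2) * Real.log (n / δ)) ∧
        (μ ≤ 4 * wbar →
          4 / ((1 - γ) * √(k : ℝ)) * √(Real.log (4 * n / δ)) ≤ ε ∧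
          4 * γ * ζ * √wbar / ((1 - γ) ^ 2 * √(μ * k)) +
            γ * ζ / (1 - γ) * (2 * γ ^ l / (1 - γ) +
              8 / ((1 - γ) * √(k : ℝ)) * √(Real.log (2 * n / δ))) +
            γ ^ l / (1 - γ) + 4 / ((1 - γ) * √(k : ℝ)) * √(Real.log (4 * n / δ)) ≤ ε) := by
  refine ⟨24576 * (1 + 7 * p), by positivity, ?_⟩
  intro n γ ζ wbar μ ε δ hn hγ0 hγ1 hζ0 hζ1 hwbar hμ hε hp hδ0 hδ1
  have ha : 0 < 1 - γ := by linarith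
  have hε1 := lt_one_of_pow_le hγ0 hp
  have hx := half_le_iterationScale (ζ := ζ) hn hγ0 hγ1 hwbar hμ hε hε1 hδ0 hδ1
  have hlpow := pow_ceil_le hγ0 hγ1 hε hp
  have hlle := ceil_le hγ0 hγ1 hε hp
  set l := ⌈(1 + 5 * p) * Real.log (1 / ε) / (1 - γ)⌉₊
  have hkle := Nat.le_ceil (8192 * iterationScale n γ ζ wbar μ ε δ)
  have hklt := Nat.ceil_lt_add_one (a := 8192 * iterationScale n γ ζ wbar μ ε δ) (by linarith)
  set k := ⌈8192 * iterationScale n γ ζ wbar μ ε δ⌉₊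
  -- The inequality `μ ≤ 4 wbar` enters only the accuracy: it will follow from the existence of a
  -- distance generating function, after `k` and `l` are fixed.
  refine ⟨k, l, Nat.ceil_pos.2 (by linarith), ?_, fun hμw => ?_⟩
  · have hk1 : (k : ℝ) + 1 ≤ 24576 * iterationScale n γ ζ wbar μ ε δ := by linarith
    simp only [totalSamples]
    push_cast
    calc ((k : ℝ) + 1) * (l * n)
        ≤ 24576 * iterationScale n γ ζ wbar μ ε δ *
            ((1 + 7 * p) * Real.log (1 / ε) / (1 - γ) * n) := by
          refine mul_le_mul hk1 ?_ (by positivity) (by linarith)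
          exact mul_le_mul_of_nonneg_right hlle (Nat.cast_nonneg n)
      _ = _ := by
          simp only [iterationScale]
          field_simp
  · obtain ⟨h1, h2⟩ := error_le hn hγ0 hγ1 hζ0 hζ1 hwbar hμ hμw hε hε1 hδ0 hδ1 hkle hlpow
    exact ⟨h1.trans (by linarith), h2⟩

end Parameters

/-! ### Pinsker's inequality and strong convexity of the negative entropy -/

section Pinsker

theorem two_mul_sub_one_le_add_one_mul_log {x : ℝ} (hx : 1 ≤ x) :
    2 * (x - 1) ≤ (x + 1) * Real.log x := by
  have h := Real.le_log_one_add_of_nonneg (x := x - 1) (by linarith)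
  rw [div_le_iff₀ (by linarith)] at h
  rw [show 1 + (x - 1) = x by ring] at h
  linarith

/-- The preceding inequality at `1 / x`. -/
theorem add_one_mul_log_le {x : ℝ} (hx0 : 0 < x) (hx : x ≤ 1) :
    (x + 1) * Real.log x ≤ 2 * (x - 1) := by
  have h := two_mul_sub_one_le_add_one_mul_log (x := x⁻¹) ((one_le_inv₀ hx0).2 hx)
  rw [Real.log_inv] at h
  have := mul_le_mul_of_nonneg_left h hx0.le
  have h1 : x * (2 * (x⁻¹ - 1)) = 2 * (1 - x) := by field_simp
  have h2 : x * ((x⁻¹ + 1) * -Real.log x) = -((x + 1) * Real.log x) := by field_simp; ring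
  rw [h1, h2] at this
  linarith

/-- The pointwise inequality behind Pinsker's inequality. -/
theorem three_mul_sq_le {x : ℝ} (hx : 0 < x) :
    3 * (x - 1) ^ 2 ≤ (2 * x + 4) * (x * Real.log x - x + 1) := by
  set f : ℝ → ℝ := fun x => (2 * x + 4) * (x * Real.log x - x + 1) - 3 * (x - 1) ^ 2 with hf
  -- By the two preceding inequalities the derivative changes sign at 1, where `f` has its minimum
  -- 0.
  have hderiv : ∀ y : ℝ, 0 < y →
      HasDerivAt f (4 * ((y + 1) * Real.log y - 2 * (y - 1))) y := by
    intro y hy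
    have h1 : HasDerivAt (fun x : ℝ => 2 * x + 4) 2 y := by
      simpa using ((hasDerivAt_id y).const_mul 2).add_const 4
    have h2 : HasDerivAt (fun x : ℝ => x * Real.log x - x + 1) (Real.log y) y := by
      have := (((Real.hasDerivAt_mul_log hy.ne').sub (hasDerivAt_id y)).add_const 1)
      simpa using this
    have h3 : HasDerivAt (fun x : ℝ => 3 * (x - 1) ^ 2) (6 * (y - 1)) y := by
      refine ((((hasDerivAt_id y).sub_const 1).pow 2).const_mul 3).congr_deriv ?_
      simp only [id_eq]
      norm_num
      ring
    exact ((h1.mul h2).sub h3).congr_deriv (by ring)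
  have hf1 : f 1 = 0 := by simp [hf]
  suffices 0 ≤ f x by simp only [hf] at this; linarith
  rcases le_total 1 x with h | h
  · have hmono : MonotoneOn f (Set.Ici 1) := by
      refine monotoneOn_of_deriv_nonneg (convex_Ici 1)
        (fun y hy => (hderiv y (lt_of_lt_of_le one_pos hy)).continuousAt.continuousWithinAt)
        (fun y hy => ?_) fun y hy => ?_
      · rw [interior_Ici] at hy
        exact (hderiv y (one_pos.trans hy)).differentiableAt.differentiableWithinAt
      · rw [interior_Ici] at hy
        rw [(hderiv y (one_pos.trans hy)).deriv]
        linarith [two_mul_sub_one_le_add_one_mul_log (Set.mem_Ioi.1 hy).le]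
    exact hf1 ▸ hmono Set.self_mem_Ici h h
  · have hanti : AntitoneOn f (Set.Ioc 0 1) := by
      refine antitoneOn_of_deriv_nonpos (convex_Ioc 0 1)
        (fun y hy => (hderiv y hy.1).continuousAt.continuousWithinAt)
        (fun y hy => ?_) fun y hy => ?_
      · rw [interior_Ioc] at hy
        exact (hderiv y hy.1).differentiableAt.differentiableWithinAt
      · rw [interior_Ioc] at hy
        rw [(hderiv y hy.1).deriv]
        linarith [add_one_mul_log_le hy.1 hy.2.le]
    exact hf1 ▸ hanti ⟨hx, h⟩ ⟨one_pos, le_rfl⟩ h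

variable {S : Type*} [Fintype S] {p q : S → ℝ}

/-- Pinsker's inequality on a finite set. -/
theorem pinsker (hp : p ∈ stdSimplex ℝ S) (hq : q ∈ stdSimplex ℝ S) (hpq : ∀ i, q i = 0 → p i = 0) :
    (∑ i, |p i - q i|) ^ 2 / 2 ≤ ∑ i, p i * Real.log (p i) - ∑ i, p i * Real.log (q i) := by
  have hpt : ∀ i, 0 ≤ p i * Real.log (p i) - p i * Real.log (q i) - p i + q i ∧
      |p i - q i| ^ 2 ≤ (2 * p i + 4 * q i) / 3 *
        (p i * Real.log (p i) - p i * Real.log (q i) - p i + q i) := by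
    intro i
    rcases (hq.1 i).eq_or_lt with h | hqi
    · simp [← h, hpq i h.symm]
    rcases (hp.1 i).eq_or_lt with h | hpi
    · simp only [← h]
      constructor
      · simpa using hqi.le
      · simp only [zero_sub, abs_neg, sq_abs]
        norm_num
        nlinarith
    have h := three_mul_sq_le (div_pos hpi hqi)
    rw [Real.log_div hpi.ne' hqi.ne'] at h
    have h' := mul_le_mul_of_nonneg_left h (sq_nonneg (q i))
    have e1 : q i ^ 2 * (3 * (p i / q i - 1) ^ 2) = 3 * (p i - q i) ^ 2 := by field_simp
    have e2 : q i ^ 2 * ((2 * (p i / q i) + 4) *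
        (p i / q i * (Real.log (p i) - Real.log (q i)) - p i / q i + 1)) =
        (2 * p i + 4 * q i) * (p i * Real.log (p i) - p i * Real.log (q i) - p i + q i) := by
      field_simp
    rw [e1, e2] at h'
    refine ⟨?_, by rw [sq_abs]; linarith⟩
    exact nonneg_of_mul_nonneg_right ((by positivity : (0 : ℝ) ≤ 3 * (p i - q i) ^ 2).trans h')
      (by positivity)
  -- Cauchy–Schwarz: the weights `(2p + 4q) / 3` have mass 2, and the other factor sums to the
  -- relative entropy.
  have h := Finset.sum_sq_le_sum_mul_sum_of_sq_le_mul Finset.univ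
    (r := fun i => |p i - q i|) (f := fun i => (2 * p i + 4 * q i) / 3)
    (g := fun i => p i * Real.log (p i) - p i * Real.log (q i) - p i + q i)
    (fun i _ => div_nonneg (add_nonneg (mul_nonneg zero_le_two (hp.1 i))
      (mul_nonneg zero_le_four (hq.1 i))) zero_le_three)
    (fun i _ => (hpt i).1) (fun i _ => (hpt i).2)
  simp only [← Finset.sum_div, Finset.sum_add_distrib, Finset.sum_sub_distrib, ← Finset.mul_sum,
    hp.2, hq.2] at h
  linarith

theorem neg_log_card_le_sum_mul_log (hp : p ∈ stdSimplex ℝ S) :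
    -Real.log (Fintype.card S) ≤ ∑ i, p i * Real.log (p i) := by
  rcases isEmpty_or_nonempty S with hS | hS
  · simp
  have hn : (0 : ℝ) < Fintype.card S := by exact_mod_cast Fintype.card_pos
  have h := pinsker hp (q := fun _ => (Fintype.card S : ℝ)⁻¹)
    ⟨fun _ => by positivity, by simp [hn.ne']⟩ fun i hi => absurd hi (by positivity)
  rw [← Finset.sum_mul, hp.2, Real.log_inv] at h
  linarith [sq_nonneg (∑ i, |p i - (Fintype.card S : ℝ)⁻¹|)]

theorem sum_mul_log_nonpos (hp : p ∈ stdSimplex ℝ S) : ∑ i, p i * Real.log (p i) ≤ 0 :=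
  Finset.sum_nonpos fun i _ => mul_nonpos_of_nonneg_of_nonpos (hp.1 i)
    (Real.log_nonpos (hp.1 i) (mem_Icc_of_mem_stdSimplex hp i).2)

/-- Strong convexity of the negative entropy with respect to the `ℓ₁`-norm. -/
theorem sum_mul_log_strong_convexity (hp : p ∈ stdSimplex ℝ S) (hq : q ∈ stdSimplex ℝ S) {τ : ℝ}
    (hτ0 : 0 < τ) (hτ1 : τ < 1) :
    ∑ i, (p i + τ * (q i - p i)) * Real.log (p i + τ * (q i - p i)) ≤
      (1 - τ) * ∑ i, p i * Real.log (p i) + τ * ∑ i, q i * Real.log (q i) -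
        τ * (1 - τ) / 2 * (∑ i, |p i - q i|) ^ 2 := by
  set m : S → ℝ := fun i => p i + τ * (q i - p i) with hm
  have hmem : m ∈ stdSimplex ℝ S := by
    have := (convex_stdSimplex ℝ S) hp hq (by linarith : 0 ≤ 1 - τ) hτ0.le (by ring)
    convert this using 1
    ext i
    simp only [hm, Pi.add_apply, Pi.smul_apply, smul_eq_mul]
    ring
  -- Both endpoints are absolutely continuous with respect to the interior point `m`, so Pinsker
  -- applies to each even on the boundary of the simplex.
  have hzero : ∀ i, m i = 0 → p i = 0 ∧ q i = 0 := by
    intro i hi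
    have h1 := mul_nonneg (by linarith : 0 ≤ 1 - τ) (hp.1 i)
    have h2 := mul_nonneg hτ0.le (hq.1 i)
    simp only [hm] at hi
    constructor
    · exact (mul_eq_zero.1 (by linarith : (1 - τ) * p i = 0)).resolve_left (by linarith)
    · exact (mul_eq_zero.1 (by linarith : τ * q i = 0)).resolve_left (by linarith)
  have hP := pinsker hp hmem fun i hi => (hzero i hi).1
  have hQ := pinsker hq hmem fun i hi => (hzero i hi).2
  have e1 : ∑ i, |p i - m i| = τ * ∑ i, |p i - q i| := by
    rw [Finset.mul_sum]
    refine Finset.sum_congr rfl fun i _ => ?_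
    rw [show p i - m i = τ * (p i - q i) by simp only [hm]; ring, abs_mul, abs_of_pos hτ0]
  have e2 : ∑ i, |q i - m i| = (1 - τ) * ∑ i, |p i - q i| := by
    rw [Finset.mul_sum]
    refine Finset.sum_congr rfl fun i _ => ?_
    rw [show q i - m i = (1 - τ) * -(p i - q i) by simp only [hm]; ring, abs_mul, abs_neg,
      abs_of_pos (by linarith : 0 < 1 - τ)]
  have e3 : ∑ i, m i * Real.log (m i) =
      (1 - τ) * ∑ i, p i * Real.log (m i) + τ * ∑ i, q i * Real.log (m i) := by
    rw [Finset.mul_sum, Finset.mul_sum, ← Finset.sum_add_distrib]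
    refine Finset.sum_congr rfl fun i _ => ?_
    simp only [hm]
    ring
  rw [e1] at hP
  rw [e2] at hQ
  have hP' := mul_le_mul_of_nonneg_left hP (by linarith : 0 ≤ 1 - τ)
  have hQ' := mul_le_mul_of_nonneg_left hQ hτ0.le
  change ∑ i, m i * Real.log (m i) ≤ _
  rw [e3]
  -- The two Pinsker terms add up through `(1 - τ) τ² + τ (1 - τ)² = τ (1 - τ)`.
  nlinarith

end Pinsker

/-! ### The weighted negative entropy as distance generating function -/

namespace Problem

variable {S A : Type*} [Fintype S] [Fintype A] (M : Problem S A)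

theorem negEntropy_strong_convexity {s : S} {D D' : A → S → ℝ} (hD : D ∈ simplexFamily S A)
    (hD' : D' ∈ simplexFamily S A) {τ : ℝ} (hτ0 : 0 < τ) (hτ1 : τ < 1) :
    M.negEntropy s (D + τ • (D' - D)) ≤ (1 - τ) * M.negEntropy s D + τ * M.negEntropy s D' -
      τ * (1 - τ) / 2 * M.sqDist s D D' := by
  have h : ∑ a, M.ϑ s a * ∑ s', (D + τ • (D' - D)) a s' * Real.log ((D + τ • (D' - D)) a s') ≤
      ∑ a, M.ϑ s a * ((1 - τ) * ∑ i, D a i * Real.log (D a i) +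
        τ * ∑ i, D' a i * Real.log (D' a i) - τ * (1 - τ) / 2 * (∑ i, |D a i - D' a i|) ^ 2) :=
    Finset.sum_le_sum fun a _ => mul_le_mul_of_nonneg_left
      (sum_mul_log_strong_convexity (hD a) (hD' a) hτ0 hτ1) ((M.ϑ_mem s).1 a)
  simp only [mul_add, mul_sub, Finset.sum_add_distrib, Finset.sum_sub_distrib,
    mul_left_comm (M.ϑ s _), ← Finset.mul_sum] at h
  simp only [negEntropy, sqDist]
  linarith

theorem isDGF_negEntropy : M.IsDGF M.negEntropy (Real.log (Fintype.card S)) 1 where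
  convexOn s := by
    refine ⟨fun D hD D' hD' a b ha hb hab i => convex_stdSimplex ℝ S (hD i) (hD' i) ha hb hab,
      fun D hD D' hD' a b ha hb hab => ?_⟩
    rcases hb.eq_or_lt with rfl | hb
    · simp [show a = 1 by linarith]
    rcases ha.eq_or_lt with rfl | ha
    · simp [show b = 1 by linarith]
    have h := M.negEntropy_strong_convexity (s := s) hD hD' hb (by linarith)
    have he : D + b • (D' - D) = a • D + b • D' := by
      rw [show a = 1 - b by linarith, smul_sub, sub_smul, one_smul]
      abel
    rw [he, show 1 - b = a by linarith] at h
    have := mul_nonneg (by positivity : 0 ≤ b * a / 2) (sqDist_nonneg (M := M) s D D')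
    rw [smul_eq_mul, smul_eq_mul]
    linarith
  nonneg s D hD := by
    have h : ∑ a, M.ϑ s a * -Real.log (Fintype.card S) ≤
        ∑ a, M.ϑ s a * ∑ s', D a s' * Real.log (D a s') :=
      Finset.sum_le_sum fun a _ =>
        mul_le_mul_of_nonneg_left (neg_log_card_le_sum_mul_log (hD a)) ((M.ϑ_mem s).1 a)
    rw [← Finset.sum_mul, (M.ϑ_mem s).2] at h
    simp only [negEntropy]
    linarith
  le_wbar s D hD := by
    have h : ∑ a, M.ϑ s a * ∑ s', D a s' * Real.log (D a s') ≤ 0 :=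
      Finset.sum_nonpos fun a _ =>
        mul_nonpos_of_nonneg_of_nonpos ((M.ϑ_mem s).1 a) (sum_mul_log_nonpos (hD a))
    simp only [negEntropy]
    linarith
  bregman_ge s D hD D' hD' g hg := by
    rw [hasDerivWithinAt_iff_tendsto_slope, Set.Ici_sdiff_left] at hg
    -- Dividing the strong convexity inequality by `τ` bounds the slope at 0; letting `τ → 0` gives
    -- the Bregman bound wherever the derivative is finite.
    have hlim : Filter.Tendsto
        (fun τ : ℝ => M.negEntropy s D' - M.negEntropy s D - (1 - τ) / 2 * M.sqDist s D D')
        (nhdsWithin 0 (Set.Ioi 0))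
        (nhds (M.negEntropy s D' - M.negEntropy s D - (1 - 0) / 2 * M.sqDist s D D')) :=
      (Continuous.tendsto (by fun_prop) 0).mono_left nhdsWithin_le_nhds
    have h := le_of_tendsto_of_tendsto hg hlim ?_
    · simp only [sqDist] at h
      linarith
    · filter_upwards [Ioo_mem_nhdsGT one_pos] with τ hτ
      rw [slope_def_field, sub_zero, div_le_iff₀ hτ.1]
      have := M.negEntropy_strong_convexity (s := s) hD hD' hτ.1 hτ.2
      simp only [zero_smul, add_zero]
      linarith

end Problem

namespace Run

theorem one_sub_le_measureReal_abs_error {S A Ω : Type*} [Fintype S] [DecidableEq S] [Fintype A]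
    [MeasurableSpace Ω] {Pr : Measure Ω} [IsProbabilityMeasure Pr] {M : Problem S A}
    {w : S → (A → S → ℝ) → ℝ} {wbar μ ε δ : ℝ} {k l : ℕ} (hwbar : 0 < wbar) (hμ : 0 < μ)
    (hw : M.IsDGF w wbar μ) (hk : 1 ≤ k) (hδ0 : 0 < δ) (hδ1 : δ < 1)
    (hlow : 4 / ((1 - M.γ) * √(k : ℝ)) * √(Real.log (4 * Fintype.card S / δ)) ≤ ε)
    (hup : 4 * M.γ * M.ζ * √wbar / ((1 - M.γ) ^ 2 * √(μ * k)) +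
      M.γ * M.ζ / (1 - M.γ) * (2 * M.γ ^ l / (1 - M.γ) +
        8 / ((1 - M.γ) * √(k : ℝ)) * √(Real.log (2 * Fintype.card S / δ))) +
      M.γ ^ l / (1 - M.γ) +
      4 / ((1 - M.γ) * √(k : ℝ)) * √(Real.log (4 * Fintype.card S / δ)) ≤ ε)
    (R : Run M w betaSeq (lamSeq M.γ M.ζ wbar μ) l Pr) :
    1 - δ ≤ Pr.real {ω | ∀ s, -ε ≤ R.output k ω s - M.natureOptValue s ∧
      R.output k ω s - M.natureOptValue s ≤ ε} :=
  (R.one_sub_le_measureReal_error hwbar hμ hw hk hδ0 hδ1).trans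
    (measureReal_mono fun _ hω s => ⟨(neg_le_neg hlow).trans (hω s).1, (hω s).2.trans hup⟩)

end Run

end RobustEval

/-! ### Conclusion -/

theorem mainTheorem5 :
    -- the error bound
    (∀ (S A Ω : Type*) [Fintype S] [DecidableEq S] [Fintype A] [MeasurableSpace Ω]
        (Pr : Measure Ω) [IsProbabilityMeasure Pr] (M : RobustEval.Problem S A)
        (w : S → (A → S → ℝ) → ℝ) (wbar μ : ℝ), 0 < wbar → 0 < μ → M.IsDGF w wbar μ →
        ∀ (l k : ℕ), 1 ≤ k → ∀ δ : ℝ, 0 < δ → δ < 1 →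
        ∀ R : RobustEval.Run M w RobustEval.betaSeq (RobustEval.lamSeq M.γ M.ζ wbar μ) l Pr,
        1 - δ ≤ Pr.real {ω | ∀ s,
          -(M.γ ^ l / (1 - M.γ) +
              4 / ((1 - M.γ) * √(k : ℝ)) * Real.log (4 * Fintype.card S / δ))
            ≤ R.output k ω s - M.natureOptValue s ∧
          R.output k ω s - M.natureOptValue s
            ≤ 4 * M.γ * M.ζ * √wbar / ((1 - M.γ) ^ 2 * √(μ * k)) +
              M.γ * M.ζ / (1 - M.γ) *
                (2 * M.γ ^ l / (1 - M.γ) +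
                  8 / ((1 - M.γ) * √(k : ℝ)) * √(Real.log (2 * Fintype.card S / δ))) +
              M.γ ^ l / (1 - M.γ) +
              4 / ((1 - M.γ) * √(k : ℝ)) * √(Real.log (4 * Fintype.card S / δ))}) ∧
    -- the sample complexity
    (∀ p : ℕ, ∃ K : ℝ, 0 < K ∧
      ∀ (n : ℕ) (γ ζ wbar μ ε δ : ℝ), 2 ≤ n → 0 ≤ γ → γ < 1 → 0 ≤ ζ → ζ ≤ 1 →
        0 < wbar → 0 < μ → 0 < ε → ε ^ p ≤ (1 - γ) / 2 → 0 < δ → δ < 1 →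
        ∃ k l : ℕ, 1 ≤ k ∧
          (RobustEval.totalSamples n l k : ℝ) ≤
            K * (γ ^ 2 * ζ ^ 2 * wbar * n * Real.log (1 / ε) / ((1 - γ) ^ 5 * μ * ε ^ 2) *
                  Real.log (n / δ) +
                n * Real.log (1 / ε) / ((1 - γ) ^ 3 * ε ^ 2) * Real.log (n / δ)) ∧
          ∀ (S A Ω : Type*) [Fintype S] [DecidableEq S] [Fintype A] [MeasurableSpace Ω]
            (Pr : Measure Ω) [IsProbabilityMeasure Pr] (M : RobustEval.Problem S A)
            (w : S → (A → S → ℝ) → ℝ),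
            Fintype.card S = n → M.γ = γ → M.ζ = ζ → M.IsDGF w wbar μ →
            ∀ R : RobustEval.Run M w RobustEval.betaSeq (RobustEval.lamSeq γ ζ wbar μ) l Pr,
            1 - δ ≤ Pr.real {ω | ∀ s,
              -ε ≤ R.output k ω s - M.natureOptValue s ∧
              R.output k ω s - M.natureOptValue s ≤ ε}) ∧
    -- the sample complexity with the weighted negative entropy
    (∀ p : ℕ, ∃ K : ℝ, 0 < K ∧
      ∀ (n : ℕ) (γ ζ ε δ : ℝ), 2 ≤ n → 0 ≤ γ → γ < 1 → 0 ≤ ζ → ζ ≤ 1 →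
        0 < ε → ε ^ p ≤ (1 - γ) / 2 → 0 < δ → δ < 1 →
        ∃ k l : ℕ, 1 ≤ k ∧
          (RobustEval.totalSamples n l k : ℝ) ≤
            K * (γ ^ 2 * ζ ^ 2 * n * Real.log n * Real.log (1 / ε) / ((1 - γ) ^ 5 * ε ^ 2) *
                  Real.log (n / δ) +
                n * Real.log (1 / ε) / ((1 - γ) ^ 3 * ε ^ 2) * Real.log (n / δ)) ∧
          ∀ (S A Ω : Type*) [Fintype S] [DecidableEq S] [Fintype A] [MeasurableSpace Ω]
            (Pr : Measure Ω) [IsProbabilityMeasure Pr] (M : RobustEval.Problem S A),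
            Fintype.card S = n → M.γ = γ → M.ζ = ζ →
            ∀ R : RobustEval.Run M M.negEntropy RobustEval.betaSeq
                (RobustEval.lamSeq γ ζ (Real.log n) 1) l Pr,
            1 - δ ≤ Pr.real {ω | ∀ s,
              -ε ≤ R.output k ω s - M.natureOptValue s ∧
              R.output k ω s - M.natureOptValue s ≤ ε}) := by
  refine ⟨?_, fun p => ?_, fun p => ?_⟩
  · intro S A Ω _ _ _ _ Pr _ M w wbar μ hwbar hμ hw l k hk δ hδ0 hδ1 R
    refine (R.one_sub_le_measureReal_error hwbar hμ hw hk hδ0 hδ1).trans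
      (measureReal_mono fun ω hω s => ⟨le_trans (neg_le_neg ?_) (hω s).1, (hω s).2⟩)
    have hγ := M.one_sub_γ_pos
    have hS : (1 : ℝ) ≤ Fintype.card S := by exact_mod_cast Fintype.card_pos_iff.2 ⟨s⟩
    have hlog : 1 ≤ Real.log (4 * Fintype.card S / δ) := by
      rw [Real.le_log_iff_exp_le (by positivity), le_div_iff₀ hδ0]
      nlinarith [Real.exp_one_lt_d9, Real.exp_pos 1]
    -- The lower bound proved above has a square root and no bias term. As the logarithm is at least
    -- 1, it implies the bound claimed here.
    have hsqrt : √(Real.log (4 * Fintype.card S / δ)) ≤ Real.log (4 * Fintype.card S / δ) := by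
      rw [Real.sqrt_le_left (by linarith)]
      nlinarith
    have hbias : 0 ≤ M.γ ^ l / (1 - M.γ) := div_nonneg (pow_nonneg M.γ_nonneg l) hγ.le
    have := mul_le_mul_of_nonneg_left hsqrt
      (div_nonneg (by norm_num : (0 : ℝ) ≤ 4) (mul_nonneg hγ.le (Real.sqrt_nonneg k)))
    linarith
  · obtain ⟨K, hK, h⟩ := RobustEval.exists_parameters p
    refine ⟨K, hK, fun n γ ζ wbar μ ε δ hn hγ0 hγ1 hζ0 hζ1 hwbar hμ hε hp hδ0 hδ1 => ?_⟩
    obtain ⟨k, l, hk, hsamples, herr⟩ :=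
      h n γ ζ wbar μ ε δ hn hγ0 hγ1 hζ0 hζ1 hwbar hμ hε hp hδ0 hδ1
    refine ⟨k, l, hk, hsamples, ?_⟩
    intro S A Ω _ _ _ _ Pr _ M w hcard hγ hζ hw R
    subst hγ hζ hcard
    have : Nontrivial S := Fintype.one_lt_card_iff_nontrivial.1 (by omega)
    obtain ⟨h1, h2⟩ := herr hw.le_four_mul
    exact R.one_sub_le_measureReal_abs_error hwbar hμ hw hk hδ0 hδ1 h1 h2
  · obtain ⟨K, hK, h⟩ := RobustEval.exists_parameters p
    refine ⟨K, hK, fun n γ ζ ε δ hn hγ0 hγ1 hζ0 hζ1 hε hp hδ0 hδ1 => ?_⟩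
    have hlog : 0 < Real.log n := Real.log_pos (by exact_mod_cast hn)
    obtain ⟨k, l, hk, hsamples, herr⟩ :=
      h n γ ζ (Real.log n) 1 ε δ hn hγ0 hγ1 hζ0 hζ1 hlog one_pos hε hp hδ0 hδ1
    refine ⟨k, l, hk, hsamples.trans (le_of_eq ?_), ?_⟩
    · rw [mul_one]
      ring
    intro S A Ω _ _ _ _ Pr _ M hcard hγ hζ R
    subst hγ hζ hcard
    have : Nontrivial S := Fintype.one_lt_card_iff_nontrivial.1 (by omega)
    obtain ⟨h1, h2⟩ := herr M.isDGF_negEntropy.le_four_mul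
    exact R.one_sub_le_measureReal_abs_error hlog one_pos M.isDGF_negEntropy hk hδ0 hδ1 h1 h2
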